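/- Let $n\ge 1$ and let $\Sigma$ be an $n$-polygraph with free track $n$-category $\Sigma^\top=\Sigma_{n-1}^*(\Sigma_n)$, that is, the $n$-category obtained from the free $n$-category on $\Sigma$ by formally inverting the generating $n$-cells. A \emph{homotopy basis} of an $n$-category $\mathcal C$ is a set $\mathcal B$ of formal $(n+1)$-cells $\beta$, each with parallel $n$-cells $s(\beta),t(\beta)$ of $\mathcal C$ as source and target, such that any two parallel $n$-cells of $\mathcal C$ are identified by the congruence generated by $s(\beta)\equiv t(\beta)$, $\beta\in\mathcal B$. Assume that $\Sigma$ has \emph{finite derivation type}: all its sets of $k$-cells ($0\le k\le n$) are finite and $\Sigma^\top$ has a finite homotopy basis. Let $\mathcal T=\Sigma^\top_{\mathrm{ab}}$ be the abelianized track $n$-category, i.e. the quotient of $\Sigma^\top$ by the relations $f\star_{n-1}g=g\star_{n-1}f$ for closed $n$-cells $f,g$ (cells with equal source and target) with the same base, and let $\overline{\mathcal T}$ be the $(n-1)$-category it presents, i.e. the quotient of the underlying $(n-1)$-category of $\mathcal T$ identifying $a$ with $b$ whenever there is an $n$-cell $a\to b$ in $\mathcal T$ (it is canonically isomorphic to the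 $(n-1)$-category $\overline\Sigma$ presented by $\Sigma$). Let $\Pi(\Sigma)$ be the natural system of identities among relations of $\Sigma$: the functor from the category of contexts of $\overline{\mathcal T}$ to abelian groups such that $\Pi(\Sigma)_u$, for an $(n-1)$-cell $u$ of $\overline{\mathcal T}$, is the abelian group with one generator $\lfloor f\rfloor$ for each closed $n$-cell $f:a\to a$ of $\mathcal T$ with $\overline a=u$ and with the relations $\lfloor f\star_{n-1}g\rfloor=\lfloor f\rfloor+\lfloor g\rfloor$ for $f,g:a\to a$ with $\overline a=u$, and $\lfloor f\star_{n-1}g\rfloor=\lfloor g\star_{n-1}f\rfloor$ for $f:a\to b$, $g:b\to a$ with $\overline a=\overline b=u$; a context $C$ acts by $C\lfloor f\rfloor=\lfloor B[f]\rfloor$, where $B$ is any context of $(n-1)$-cells of $\mathcal T$ lifting $C$. A set $X$ of elements $x\in\Pi(\Sigma)_{u_x}$ \emph{generates} $\Pi(\Sigma)$ if every group $\Pi(\Sigma)_v$ is generated by the elements $C[x]$ with $x\in X$ and $C$ a context from $u_x$ to $v$. Then the natural system $\Pi(\Sigma)$ is finitely generated, i.e. it is generated by a finite set. More precisely, $\mathcal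 T$ has a finite homotopy basis, and for every homotopy basis $\mathcal B$ of $\mathcal T$ (in particular every finite one) the elements $\lfloor s(\beta)\star_{n-1}t(\beta)^-\rfloor$, $\beta\in\mathcal B$, generate $\Pi(\Sigma)$. -/

import Mathlib

universe u

noncomputable section

/-! ### Strict `n`-categories -/

/-- A (small, strict, globular) `n`-category, in the single-sorted presentation: `Cell` is the set
of `n`-cells, and for `k < n` a `k`-cell is identified with the identity `n`-cell on it, so that
the `k`-cells are the `x` with `src k x = x` (equivalently `tgt k x = x`).  `src i` and `tgt i` are
the `i`-source and the `i`-target, and `comp i x y` is the `i`-composite, defined when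
`tgt i x = src i y`. -/
structure NCat (n : ℕ) : Type (u + 1) where
  Cell : Type u
  src : Fin n → Cell → Cell
  tgt : Fin n → Cell → Cell
  comp : (i : Fin n) → (x y : Cell) → tgt i x = src i y → Cell
  /-- a `j`-cell is an `i`-cell for `j ≤ i` -/
  src_src_of_le : ∀ {i j : Fin n}, j ≤ i → ∀ x, src i (src j x) = src j x
  tgt_src_of_le : ∀ {i j : Fin n}, j ≤ i → ∀ x, tgt i (src j x) = src j x
  src_tgt_of_le : ∀ {i j : Fin n}, j ≤ i → ∀ x, src i (tgt j x) = tgt j x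
  tgt_tgt_of_le : ∀ {i j : Fin n}, j ≤ i → ∀ x, tgt i (tgt j x) = tgt j x
  /-- the globular relations -/
  src_src_of_lt : ∀ {i j : Fin n}, i < j → ∀ x, src i (src j x) = src i x
  src_tgt_of_lt : ∀ {i j : Fin n}, i < j → ∀ x, src i (tgt j x) = src i x
  tgt_src_of_lt : ∀ {i j : Fin n}, i < j → ∀ x, tgt i (src j x) = tgt i x
  tgt_tgt_of_lt : ∀ {i j : Fin n}, i < j → ∀ x, tgt i (tgt j x) = tgt i x
  /-- sources and targets of composites -/
  src_comp : ∀ i x y h, src i (comp i x y h) = src i x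
  tgt_comp : ∀ i x y h, tgt i (comp i x y h) = tgt i y
  src_comp_of_lt : ∀ {i j : Fin n}, i < j → ∀ x y h h',
    src j (comp i x y h) = comp i (src j x) (src j y) h'
  tgt_comp_of_lt : ∀ {i j : Fin n}, i < j → ∀ x y h h',
    tgt j (comp i x y h) = comp i (tgt j x) (tgt j y) h'
  /-- units, associativity, exchange -/
  id_comp : ∀ i x h, comp i (src i x) x h = x
  comp_id : ∀ i x h, comp i x (tgt i x) h = x
  assoc : ∀ i x y z h₁ h₂ h₃ h₄, comp i (comp i x y h₁) z h₂ = comp i x (comp i y z h₃) h₄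
  exchange : ∀ {i j : Fin n}, i < j → ∀ x y z w h₁ h₂ h₃ h₄ h₅ h₆,
    comp i (comp j x y h₁) (comp j z w h₂) h₃ = comp j (comp i x z h₄) (comp i y w h₅) h₆

namespace NCat

variable {n : ℕ}

theorem comp_congr (C : NCat.{u} n) {i : Fin n} {x x' y y' : C.Cell} {h : C.tgt i x = C.src i y}
    (hx : x = x') (hy : y = y') :
    C.comp i x y h = C.comp i x' y' (by rw [← hx, ← hy, h]) := by
  subst hx hy; rfl

/-- Two `n`-cells are parallel when they have the same sources and the same targets. -/
def Parallel (C : NCat.{u} n) (x y : C.Cell) : Prop :=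
  ∀ i, C.src i x = C.src i y ∧ C.tgt i x = C.tgt i y

theorem Parallel.refl (C : NCat.{u} n) (x : C.Cell) : C.Parallel x x := fun _ => ⟨rfl, rfl⟩

theorem Parallel.symm {C : NCat.{u} n} {x y : C.Cell} (h : C.Parallel x y) : C.Parallel y x :=
  fun i => ⟨(h i).1.symm, (h i).2.symm⟩

theorem Parallel.trans {C : NCat.{u} n} {x y z : C.Cell} (h : C.Parallel x y)
    (h' : C.Parallel y z) : C.Parallel x z :=
  fun i => ⟨(h i).1.trans (h' i).1, (h i).2.trans (h' i).2⟩

theorem comp_cond {C : NCat.{u} n} {x x' y y' : C.Cell} (hx : C.Parallel x x')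
    (hy : C.Parallel y y') {i : Fin n} (h : C.tgt i x = C.src i y) : C.tgt i x' = C.src i y' := by
  rw [← (hx i).2, ← (hy i).1, h]

theorem src_comp_of_gt (C : NCat.{u} n) {i j : Fin n} (hij : j < i) (x y h) :
    C.src j (C.comp i x y h) = C.src j x := by
  rw [← C.src_src_of_lt hij, C.src_comp, C.src_src_of_lt hij]

theorem tgt_comp_of_gt (C : NCat.{u} n) {i j : Fin n} (hij : j < i) (x y h) :
    C.tgt j (C.comp i x y h) = C.tgt j y := by
  rw [← C.tgt_tgt_of_lt hij, C.tgt_comp, C.tgt_tgt_of_lt hij]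

theorem src_eq_of_gt (C : NCat.{u} n) {i j : Fin n} (hij : j < i) {x y : C.Cell}
    (h : C.tgt i x = C.src i y) : C.src j x = C.src j y := by
  rw [← C.src_tgt_of_lt hij, h, C.src_src_of_lt hij]

theorem tgt_eq_of_gt (C : NCat.{u} n) {i j : Fin n} (hij : j < i) {x y : C.Cell}
    (h : C.tgt i x = C.src i y) : C.tgt j x = C.tgt j y := by
  rw [← C.tgt_tgt_of_lt hij, h, C.tgt_src_of_lt hij]

theorem comp_cond_src (C : NCat.{u} n) {i j : Fin n} (hij : i < j) {x y : C.Cell}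
    (h : C.tgt i x = C.src i y) : C.tgt i (C.src j x) = C.src i (C.src j y) := by
  rw [C.tgt_src_of_lt hij, C.src_src_of_lt hij, h]

theorem comp_cond_tgt (C : NCat.{u} n) {i j : Fin n} (hij : i < j) {x y : C.Cell}
    (h : C.tgt i x = C.src i y) : C.tgt i (C.tgt j x) = C.src i (C.tgt j y) := by
  rw [C.tgt_tgt_of_lt hij, C.src_tgt_of_lt hij, h]

theorem Parallel.comp {C : NCat.{u} n} {x x' y y' : C.Cell} (hx : C.Parallel x x')
    (hy : C.Parallel y y') (i : Fin n) (h : C.tgt i x = C.src i y)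
    (h' : C.tgt i x' = C.src i y') : C.Parallel (C.comp i x y h) (C.comp i x' y' h') := by
  intro j
  rcases lt_trichotomy i j with hij | rfl | hij
  · rw [C.src_comp_of_lt hij _ _ _ (C.comp_cond_src hij h),
      C.src_comp_of_lt hij _ _ _ (C.comp_cond_src hij h'),
      C.tgt_comp_of_lt hij _ _ _ (C.comp_cond_tgt hij h),
      C.tgt_comp_of_lt hij _ _ _ (C.comp_cond_tgt hij h')]
    exact ⟨C.comp_congr (hx j).1 (hy j).1, C.comp_congr (hx j).2 (hy j).2⟩
  · rw [C.src_comp, C.src_comp, C.tgt_comp, C.tgt_comp]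
    exact ⟨(hx i).1, (hy i).2⟩
  · rw [C.src_comp_of_gt hij, C.src_comp_of_gt hij, C.tgt_comp_of_gt hij, C.tgt_comp_of_gt hij]
    exact ⟨(hx j).1, (hy j).2⟩

/-- A set, as a `0`-category. -/
def discrete (X : Type u) : NCat.{u} 0 where
  Cell := X
  src i := i.elim0
  tgt i := i.elim0
  comp i := i.elim0
  src_src_of_le {i} := i.elim0
  tgt_src_of_le {i} := i.elim0
  src_tgt_of_le {i} := i.elim0
  tgt_tgt_of_le {i} := i.elim0
  src_src_of_lt {i} := i.elim0
  src_tgt_of_lt {i} := i.elim0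
  tgt_src_of_lt {i} := i.elim0
  tgt_tgt_of_lt {i} := i.elim0
  src_comp i := i.elim0
  tgt_comp i := i.elim0
  src_comp_of_lt {i} := i.elim0
  tgt_comp_of_lt {i} := i.elim0
  id_comp i := i.elim0
  comp_id i := i.elim0
  assoc i := i.elim0
  exchange {i} := i.elim0

/-- The `(n+1)`-cells of an `(n+1)`-category with their compositions `⋆_i`, `i < n`; they form an
`n`-category, whose cells of dimension `< n` are those of the given one. -/
def forget (T : NCat.{u} (n + 1)) : NCat.{u} n where
  Cell := T.Cell
  src i := T.src i.castSucc
  tgt i := T.tgt i.castSucc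
  comp i := T.comp i.castSucc
  src_src_of_le h := T.src_src_of_le (Fin.castSucc_le_castSucc_iff.2 h)
  tgt_src_of_le h := T.tgt_src_of_le (Fin.castSucc_le_castSucc_iff.2 h)
  src_tgt_of_le h := T.src_tgt_of_le (Fin.castSucc_le_castSucc_iff.2 h)
  tgt_tgt_of_le h := T.tgt_tgt_of_le (Fin.castSucc_le_castSucc_iff.2 h)
  src_src_of_lt h := T.src_src_of_lt (Fin.castSucc_lt_castSucc_iff.2 h)
  src_tgt_of_lt h := T.src_tgt_of_lt (Fin.castSucc_lt_castSucc_iff.2 h)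
  tgt_src_of_lt h := T.tgt_src_of_lt (Fin.castSucc_lt_castSucc_iff.2 h)
  tgt_tgt_of_lt h := T.tgt_tgt_of_lt (Fin.castSucc_lt_castSucc_iff.2 h)
  src_comp _ := T.src_comp _
  tgt_comp _ := T.tgt_comp _
  src_comp_of_lt h := T.src_comp_of_lt (Fin.castSucc_lt_castSucc_iff.2 h)
  tgt_comp_of_lt h := T.tgt_comp_of_lt (Fin.castSucc_lt_castSucc_iff.2 h)
  id_comp _ := T.id_comp _
  comp_id _ := T.comp_id _
  assoc _ := T.assoc _
  exchange h := T.exchange (Fin.castSucc_lt_castSucc_iff.2 h)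

/-- The sub-`n`-category on a set of cells stable under sources, targets and compositions. -/
def sub (C : NCat.{u} n) (P : C.Cell → Prop) (hs : ∀ i x, P x → P (C.src i x))
    (ht : ∀ i x, P x → P (C.tgt i x)) (hc : ∀ i x y h, P x → P y → P (C.comp i x y h)) :
    NCat.{u} n where
  Cell := {x : C.Cell // P x}
  src i x := ⟨C.src i x.1, hs i x.1 x.2⟩
  tgt i x := ⟨C.tgt i x.1, ht i x.1 x.2⟩
  comp i x y h := ⟨C.comp i x.1 y.1 (congrArg Subtype.val h), hc i x.1 y.1 _ x.2 y.2⟩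
  src_src_of_le h x := Subtype.ext (C.src_src_of_le h x.1)
  tgt_src_of_le h x := Subtype.ext (C.tgt_src_of_le h x.1)
  src_tgt_of_le h x := Subtype.ext (C.src_tgt_of_le h x.1)
  tgt_tgt_of_le h x := Subtype.ext (C.tgt_tgt_of_le h x.1)
  src_src_of_lt h x := Subtype.ext (C.src_src_of_lt h x.1)
  src_tgt_of_lt h x := Subtype.ext (C.src_tgt_of_lt h x.1)
  tgt_src_of_lt h x := Subtype.ext (C.tgt_src_of_lt h x.1)
  tgt_tgt_of_lt h x := Subtype.ext (C.tgt_tgt_of_lt h x.1)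
  src_comp i x y _ := Subtype.ext (C.src_comp i x.1 y.1 _)
  tgt_comp i x y _ := Subtype.ext (C.tgt_comp i x.1 y.1 _)
  src_comp_of_lt h x y _ _ := Subtype.ext (C.src_comp_of_lt h x.1 y.1 _ _)
  tgt_comp_of_lt h x y _ _ := Subtype.ext (C.tgt_comp_of_lt h x.1 y.1 _ _)
  id_comp i x _ := Subtype.ext (C.id_comp i x.1 _)
  comp_id i x _ := Subtype.ext (C.comp_id i x.1 _)
  assoc i x y z _ _ _ _ := Subtype.ext (C.assoc i x.1 y.1 z.1 _ _ _ _)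
  exchange h x y z w _ _ _ _ _ _ := Subtype.ext (C.exchange h x.1 y.1 z.1 w.1 _ _ _ _ _ _)

/-- The underlying `n`-category of an `(n+1)`-category: keep the cells of dimension `≤ n`. -/
def trunc (T : NCat.{u} (n + 1)) : NCat.{u} n :=
  T.forget.sub (fun x => T.src (Fin.last n) x = x)
    (fun i x _ => T.src_src_of_le (Fin.le_last _) x)
    (fun i x _ => T.src_tgt_of_le (Fin.le_last _) x)
    (fun i x y h hx hy => by
      have hx' : T.src (Fin.last n) x = x := hx
      have hy' : T.src (Fin.last n) y = y := hy
      have := T.src_comp_of_lt (Fin.castSucc_lt_last i) x y h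
        (T.comp_cond_src (Fin.castSucc_lt_last i) h)
      exact this.trans (T.comp_congr hx' hy'))

/-! ### `n`-functors -/

end NCat

/-- An `n`-functor. -/
structure NFunctor {n : ℕ} (C D : NCat.{u} n) : Type u where
  map : C.Cell → D.Cell
  map_src : ∀ i x, map (C.src i x) = D.src i (map x)
  map_tgt : ∀ i x, map (C.tgt i x) = D.tgt i (map x)
  map_comp : ∀ i x y h h', map (C.comp i x y h) = D.comp i (map x) (map y) h'

namespace NFunctor

variable {n : ℕ} {C D : NCat.{u} n}

theorem cond (F : NFunctor C D) {i : Fin n} {x y : C.Cell} (h : C.tgt i x = C.src i y) :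
    D.tgt i (F.map x) = D.src i (F.map y) := by
  rw [← F.map_tgt, ← F.map_src, h]

end NFunctor

/-! ### Cellular extensions, quotients and free extensions -/

/-- A cellular extension of an `n`-category `C`: a set of formal `(n+1)`-cells, each with a source
and a target that are parallel `n`-cells of `C`. -/
structure CellExt {n : ℕ} (C : NCat.{u} n) : Type (u + 1) where
  Gen : Type u
  s : Gen → C.Cell
  t : Gen → C.Cell
  parallel : ∀ γ, C.Parallel (s γ) (t γ)

namespace CellExt

variable {n : ℕ} {C : NCat.{u} n}

/-- The congruence `≡_Γ` on the `n`-cells of `C` generated by `s γ ≡ t γ` for `γ` in `Γ`. -/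
inductive Cong (Γ : CellExt.{u} C) : C.Cell → C.Cell → Prop
  | gen (γ : Γ.Gen) : Cong Γ (Γ.s γ) (Γ.t γ)
  | refl (x : C.Cell) : Cong Γ x x
  | symm {x y : C.Cell} : Cong Γ x y → Cong Γ y x
  | trans {x y z : C.Cell} : Cong Γ x y → Cong Γ y z → Cong Γ x z
  | comp (i : Fin n) {x x' y y' : C.Cell} (h : C.tgt i x = C.src i y)
      (h' : C.tgt i x' = C.src i y') : Cong Γ x x' → Cong Γ y y' →
      Cong Γ (C.comp i x y h) (C.comp i x' y' h')

theorem Cong.parallel {Γ : CellExt.{u} C} {x y : C.Cell} (h : Γ.Cong x y) : C.Parallel x y := by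
  induction h with
  | gen γ => exact Γ.parallel γ
  | refl x => exact .refl C x
  | symm _ ih => exact ih.symm
  | trans _ _ ih₁ ih₂ => exact ih₁.trans ih₂
  | comp i h h' _ _ ih₁ ih₂ => exact ih₁.comp ih₂ i h h'

/-- `Γ` is a homotopy basis of `C` when `f ≡_Γ g` for every pair of parallel `n`-cells. -/
def IsHomotopyBasis (Γ : CellExt.{u} C) : Prop :=
  ∀ f g : C.Cell, C.Parallel f g → Γ.Cong f g

def congSetoid (Γ : CellExt.{u} C) : Setoid C.Cell :=
  ⟨Γ.Cong, ⟨.refl, .symm, .trans⟩⟩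

/-- The cells of the quotient `C / Γ`; since congruent cells are parallel, cells of dimension `< n`
are not identified. -/
def QCell (Γ : CellExt.{u} C) : Type u := Quotient Γ.congSetoid

def cls (Γ : CellExt.{u} C) (x : C.Cell) : Γ.QCell := Quotient.mk Γ.congSetoid x

def qout (Γ : CellExt.{u} C) (p : Γ.QCell) : C.Cell := Quotient.out p

theorem cls_qout (Γ : CellExt.{u} C) (p : Γ.QCell) : Γ.cls (Γ.qout p) = p := Quotient.out_eq p

theorem cls_surj (Γ : CellExt.{u} C) (p : Γ.QCell) : ∃ x, Γ.cls x = p := ⟨_, Γ.cls_qout p⟩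

theorem cls_eq {Γ : CellExt.{u} C} {x y : C.Cell} : Γ.cls x = Γ.cls y ↔ Γ.Cong x y :=
  ⟨fun h => Quotient.exact h, fun h => Quotient.sound (s := Γ.congSetoid) h⟩

def qsrc (Γ : CellExt.{u} C) (i : Fin n) (p : Γ.QCell) : Γ.QCell :=
  Γ.cls (C.src i (Γ.qout p))

def qtgt (Γ : CellExt.{u} C) (i : Fin n) (p : Γ.QCell) : Γ.QCell :=
  Γ.cls (C.tgt i (Γ.qout p))

theorem qsrc_cls (Γ : CellExt.{u} C) (i : Fin n) (x : C.Cell) :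
    Γ.qsrc i (Γ.cls x) = Γ.cls (C.src i x) :=
  congrArg Γ.cls ((cls_eq.1 (Γ.cls_qout (Γ.cls x))).parallel i).1

theorem qtgt_cls (Γ : CellExt.{u} C) (i : Fin n) (x : C.Cell) :
    Γ.qtgt i (Γ.cls x) = Γ.cls (C.tgt i x) :=
  congrArg Γ.cls ((cls_eq.1 (Γ.cls_qout (Γ.cls x))).parallel i).2

theorem cond_of_cls {Γ : CellExt.{u} C} {i : Fin n} {x y : C.Cell}
    (h : Γ.qtgt i (Γ.cls x) = Γ.qsrc i (Γ.cls y)) : C.tgt i x = C.src i y := by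
  rw [qtgt_cls, qsrc_cls] at h
  have := ((cls_eq.1 h).parallel i).1
  rwa [C.src_tgt_of_le le_rfl, C.src_src_of_le le_rfl] at this

theorem cond_qout {Γ : CellExt.{u} C} {i : Fin n} {p q : Γ.QCell}
    (h : Γ.qtgt i p = Γ.qsrc i q) : C.tgt i (Γ.qout p) = C.src i (Γ.qout q) :=
  cond_of_cls (Γ := Γ) (by rwa [cls_qout, cls_qout])

def qcomp (Γ : CellExt.{u} C) (i : Fin n) (p q : Γ.QCell) (h : Γ.qtgt i p = Γ.qsrc i q) :
    Γ.QCell :=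
  Γ.cls (C.comp i (Γ.qout p) (Γ.qout q) (cond_qout h))

theorem qcomp_cls (Γ : CellExt.{u} C) (i : Fin n) (x y : C.Cell)
    (h : Γ.qtgt i (Γ.cls x) = Γ.qsrc i (Γ.cls y)) :
    Γ.qcomp i (Γ.cls x) (Γ.cls y) h = Γ.cls (C.comp i x y (cond_of_cls h)) :=
  cls_eq.2 (.comp i _ _ (cls_eq.1 (Γ.cls_qout _)) (cls_eq.1 (Γ.cls_qout _)))

/-- The quotient `n`-category `C / Γ`. -/
def quotient (Γ : CellExt.{u} C) : NCat.{u} n where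
  Cell := Γ.QCell
  src := Γ.qsrc
  tgt := Γ.qtgt
  comp := Γ.qcomp
  src_src_of_le h p := by
    obtain ⟨x, rfl⟩ := Γ.cls_surj p
    simp only [qsrc_cls, C.src_src_of_le h]
  tgt_src_of_le h p := by
    obtain ⟨x, rfl⟩ := Γ.cls_surj p
    simp only [qsrc_cls, qtgt_cls, C.tgt_src_of_le h]
  src_tgt_of_le h p := by
    obtain ⟨x, rfl⟩ := Γ.cls_surj p
    simp only [qsrc_cls, qtgt_cls, C.src_tgt_of_le h]
  tgt_tgt_of_le h p := by
    obtain ⟨x, rfl⟩ := Γ.cls_surj p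
    simp only [qtgt_cls, C.tgt_tgt_of_le h]
  src_src_of_lt h p := by
    obtain ⟨x, rfl⟩ := Γ.cls_surj p
    simp only [qsrc_cls, C.src_src_of_lt h]
  src_tgt_of_lt h p := by
    obtain ⟨x, rfl⟩ := Γ.cls_surj p
    simp only [qsrc_cls, qtgt_cls, C.src_tgt_of_lt h]
  tgt_src_of_lt h p := by
    obtain ⟨x, rfl⟩ := Γ.cls_surj p
    simp only [qsrc_cls, qtgt_cls, C.tgt_src_of_lt h]
  tgt_tgt_of_lt h p := by
    obtain ⟨x, rfl⟩ := Γ.cls_surj p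
    simp only [qtgt_cls, C.tgt_tgt_of_lt h]
  src_comp i p q h := by
    obtain ⟨x, rfl⟩ := Γ.cls_surj p
    obtain ⟨y, rfl⟩ := Γ.cls_surj q
    simp only [qcomp_cls, qsrc_cls, C.src_comp]
  tgt_comp i p q h := by
    obtain ⟨x, rfl⟩ := Γ.cls_surj p
    obtain ⟨y, rfl⟩ := Γ.cls_surj q
    simp only [qcomp_cls, qtgt_cls, C.tgt_comp]
  src_comp_of_lt hij p q h h' := by
    obtain ⟨x, rfl⟩ := Γ.cls_surj p
    obtain ⟨y, rfl⟩ := Γ.cls_surj q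
    simp only [qcomp_cls, qsrc_cls]
    rw [C.src_comp_of_lt hij]
  tgt_comp_of_lt hij p q h h' := by
    obtain ⟨x, rfl⟩ := Γ.cls_surj p
    obtain ⟨y, rfl⟩ := Γ.cls_surj q
    simp only [qcomp_cls, qtgt_cls]
    rw [C.tgt_comp_of_lt hij]
  id_comp i p h := by
    obtain ⟨x, rfl⟩ := Γ.cls_surj p
    simp only [qcomp_cls, qsrc_cls, C.id_comp]
  comp_id i p h := by
    obtain ⟨x, rfl⟩ := Γ.cls_surj p
    simp only [qcomp_cls, qtgt_cls, C.comp_id]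
  assoc i p q r h₁ h₂ h₃ h₄ := by
    obtain ⟨x, rfl⟩ := Γ.cls_surj p
    obtain ⟨y, rfl⟩ := Γ.cls_surj q
    obtain ⟨z, rfl⟩ := Γ.cls_surj r
    simp only [qcomp_cls]
    rw [C.assoc]
  exchange hij p q r s h₁ h₂ h₃ h₄ h₅ h₆ := by
    obtain ⟨x, rfl⟩ := Γ.cls_surj p
    obtain ⟨y, rfl⟩ := Γ.cls_surj q
    obtain ⟨z, rfl⟩ := Γ.cls_surj r
    obtain ⟨w, rfl⟩ := Γ.cls_surj s
    simp only [qcomp_cls]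
    rw [C.exchange hij]

/-- Formal composites of elements of `Γ` and of identities of `n`-cells of `C`, seen as
`(n+1)`-cells from `a` to `b`: `top` is the composition `⋆_n`, `low i` is `⋆_i` for `i < n`. -/
inductive Term (Γ : CellExt.{u} C) : C.Cell → C.Cell → Type u
  | gen (γ : Γ.Gen) : Term Γ (Γ.s γ) (Γ.t γ)
  | id (a : C.Cell) : Term Γ a a
  | top {a b c : C.Cell} (p : Term Γ a b) (q : Term Γ b c) : Term Γ a c
  | low (i : Fin n) {a b a' b' : C.Cell} (p : Term Γ a b) (q : Term Γ a' b')
      (h : C.tgt i a = C.src i a') (h' : C.tgt i b = C.src i b') :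
      Term Γ (C.comp i a a' h) (C.comp i b b' h')

namespace Term

/-- The congruence on formal composites generated by the axioms of `(n+1)`-categories. -/
inductive Rel {Γ : CellExt.{u} C} : ∀ {a b a' b' : C.Cell}, Γ.Term a b → Γ.Term a' b' → Prop
  | refl {a b} (p : Γ.Term a b) : Rel p p
  | symm {a b a' b'} {p : Γ.Term a b} {q : Γ.Term a' b'} : Rel p q → Rel q p
  | trans {a b a' b' a'' b''} {p : Γ.Term a b} {q : Γ.Term a' b'} {r : Γ.Term a'' b''} :
      Rel p q → Rel q r → Rel p r
  | top_congr {a b c a' b' c'} {p : Γ.Term a b} {q : Γ.Term b c} {p' : Γ.Term a' b'}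
      {q' : Γ.Term b' c'} : Rel p p' → Rel q q' → Rel (top p q) (top p' q')
  | low_congr (i : Fin n) {a b a' b' c d c' d'} {p : Γ.Term a b} {q : Γ.Term a' b'}
      {p' : Γ.Term c d} {q' : Γ.Term c' d'} (h₁ h₂ h₃ h₄) :
      Rel p p' → Rel q q' → Rel (low i p q h₁ h₂) (low i p' q' h₃ h₄)
  | top_assoc {a b c d} (p : Γ.Term a b) (q : Γ.Term b c) (r : Γ.Term c d) :
      Rel (top (top p q) r) (top p (top q r))
  | id_top {a b} (p : Γ.Term a b) : Rel (top (id a) p) p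
  | top_id {a b} (p : Γ.Term a b) : Rel (top p (id b)) p
  | low_assoc (i : Fin n) {a b a' b' a'' b''} (p : Γ.Term a b) (q : Γ.Term a' b')
      (r : Γ.Term a'' b'') (h₁ h₂ h₃ h₄ h₅ h₆ h₇ h₈) :
      Rel (low i (low i p q h₁ h₂) r h₃ h₄) (low i p (low i q r h₅ h₆) h₇ h₈)
  | id_low (i : Fin n) {a b} (p : Γ.Term a b) (h₁ h₂) : Rel (low i (id (C.src i a)) p h₁ h₂) p
  | low_id (i : Fin n) {a b} (p : Γ.Term a b) (h₁ h₂) : Rel (low i p (id (C.tgt i a)) h₁ h₂) p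
  | low_id_id (i : Fin n) (a b : C.Cell) (h₁ h₂) :
      Rel (low i (id a) (id b) h₁ h₂) (id (C.comp i a b h₁))
  | exchange_top (i : Fin n) {a b c a' b' c'} (p : Γ.Term a b) (q : Γ.Term b c)
      (p' : Γ.Term a' b') (q' : Γ.Term b' c') (h₁ h₂ h₃) :
      Rel (low i (top p q) (top p' q') h₁ h₂) (top (low i p p' h₁ h₃) (low i q q' h₃ h₂))
  | exchange_low {i j : Fin n} (hij : i < j) {a b c d a' b' c' d'} (p : Γ.Term a b)
      (q : Γ.Term c d) (p' : Γ.Term a' b') (q' : Γ.Term c' d')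
      (h₁ h₂ h₃ h₄ h₅ h₆ h₇ h₈ h₉ h₁₀ h₁₁ h₁₂) :
      Rel (low i (low j p q h₁ h₂) (low j p' q' h₃ h₄) h₅ h₆)
        (low j (low i p p' h₇ h₈) (low i q q' h₉ h₁₀) h₁₁ h₁₂)

theorem parallel {Γ : CellExt.{u} C} {a b : C.Cell} (p : Γ.Term a b) : C.Parallel a b := by
  induction p with
  | gen γ => exact Γ.parallel γ
  | id a => exact .refl C a
  | top _ _ ih₁ ih₂ => exact ih₁.trans ih₂
  | low i _ _ h h' ih₁ ih₂ => exact ih₁.comp ih₂ i h h'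

theorem Rel.eq {Γ : CellExt.{u} C} {a b a' b' : C.Cell} {p : Γ.Term a b} {q : Γ.Term a' b'}
    (h : Rel p q) : a = a' ∧ b = b' := by
  induction h with
  | refl => exact ⟨rfl, rfl⟩
  | symm _ ih => exact ⟨ih.1.symm, ih.2.symm⟩
  | trans _ _ ih₁ ih₂ => exact ⟨ih₁.1.trans ih₂.1, ih₁.2.trans ih₂.2⟩
  | top_congr _ _ ih₁ ih₂ => exact ⟨ih₁.1, ih₂.2⟩
  | low_congr i h₁ h₂ h₃ h₄ _ _ ih₁ ih₂ =>
    exact ⟨C.comp_congr ih₁.1 ih₂.1, C.comp_congr ih₁.2 ih₂.2⟩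
  | top_assoc => exact ⟨rfl, rfl⟩
  | id_top => exact ⟨rfl, rfl⟩
  | top_id => exact ⟨rfl, rfl⟩
  | low_assoc => exact ⟨C.assoc _ _ _ _ _ _ _ _, C.assoc _ _ _ _ _ _ _ _⟩
  | id_low i p h₁ h₂ =>
    refine ⟨C.id_comp _ _ _, ?_⟩
    rw [C.comp_congr (p.parallel i).1 rfl, C.id_comp]
  | low_id i p h₁ h₂ =>
    refine ⟨C.comp_id _ _ _, ?_⟩
    rw [C.comp_congr rfl (p.parallel i).2, C.comp_id]
  | low_id_id => exact ⟨rfl, rfl⟩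
  | exchange_top => exact ⟨rfl, rfl⟩
  | exchange_low hij => exact ⟨C.exchange hij _ _ _ _ _ _ _ _ _ _, C.exchange hij _ _ _ _ _ _ _ _ _ _⟩

end Term

/-- Formal composites with arbitrary source and target. -/
def Raw (Γ : CellExt.{u} C) : Type u := (a : C.Cell) × (b : C.Cell) × Γ.Term a b

def rawSetoid (Γ : CellExt.{u} C) : Setoid Γ.Raw where
  r p q := Term.Rel p.2.2 q.2.2
  iseqv := ⟨fun p => .refl p.2.2, .symm, .trans⟩

/-- The `(n+1)`-cells of the free extension `C[Γ]`. -/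
def FCell (Γ : CellExt.{u} C) : Type u := Quotient Γ.rawSetoid

def fmk (Γ : CellExt.{u} C) {a b : C.Cell} (p : Γ.Term a b) : Γ.FCell :=
  Quotient.mk Γ.rawSetoid ⟨a, b, p⟩

theorem fmk_eq {Γ : CellExt.{u} C} {a b a' b' : C.Cell} {p : Γ.Term a b} {q : Γ.Term a' b'} :
    Γ.fmk p = Γ.fmk q ↔ Term.Rel p q :=
  ⟨fun h => Quotient.exact h, fun h => Quotient.sound (s := Γ.rawSetoid) h⟩

theorem fmk_surj (Γ : CellExt.{u} C) (x : Γ.FCell) : ∃ (a b : C.Cell) (p : Γ.Term a b), Γ.fmk p = x :=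
  ⟨_, _, (Quotient.out x).2.2, Quotient.out_eq x⟩

/-- The source `n`-cell of an `(n+1)`-cell of `C[Γ]`. -/
def fdom (Γ : CellExt.{u} C) (x : Γ.FCell) : C.Cell :=
  Quotient.lift (fun p : Γ.Raw => p.1) (fun _ _ h => (Term.Rel.eq h).1) x

/-- The target `n`-cell of an `(n+1)`-cell of `C[Γ]`. -/
def fcod (Γ : CellExt.{u} C) (x : Γ.FCell) : C.Cell :=
  Quotient.lift (fun p : Γ.Raw => p.2.1) (fun _ _ h => (Term.Rel.eq h).2) x

theorem fdom_fmk (Γ : CellExt.{u} C) {a b : C.Cell} (p : Γ.Term a b) : Γ.fdom (Γ.fmk p) = a := rfl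
theorem fcod_fmk (Γ : CellExt.{u} C) {a b : C.Cell} (p : Γ.Term a b) : Γ.fcod (Γ.fmk p) = b := rfl

set_option linter.unusedSimpArgs false

/-- The identity `(n+1)`-cell of `C[Γ]` on an `n`-cell of `C`. -/
def fid (Γ : CellExt.{u} C) (a : C.Cell) : Γ.FCell := Γ.fmk (.id a)

theorem fid_inj {Γ : CellExt.{u} C} {a b : C.Cell} (h : Γ.fid a = Γ.fid b) : a = b :=
  (fmk_eq.1 h).eq.1

/-- `(n+1)`-composition of formal composites, along an equality of `n`-cells. -/
def Term.topH {Γ : CellExt.{u} C} {a b b' c : C.Cell} (p : Γ.Term a b) (q : Γ.Term b' c)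
    (h : b = b') : Γ.Term a c := Term.top p (h ▸ q)

theorem Term.topH_congr {Γ : CellExt.{u} C} {a b b' c a₁ b₁ b₁' c₁ : C.Cell} {p : Γ.Term a b}
    {q : Γ.Term b' c} {p₁ : Γ.Term a₁ b₁} {q₁ : Γ.Term b₁' c₁} (h : b = b') (h₁ : b₁ = b₁')
    (hp : Term.Rel p p₁) (hq : Term.Rel q q₁) : Term.Rel (p.topH q h) (p₁.topH q₁ h₁) := by
  subst h h₁
  exact .top_congr hp hq

def fout (Γ : CellExt.{u} C) (x : Γ.FCell) : Γ.Raw := Quotient.out x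

theorem fmk_fout (Γ : CellExt.{u} C) (x : Γ.FCell) : Γ.fmk (Γ.fout x).2.2 = x :=
  Quotient.out_eq x

theorem fout_fmk (Γ : CellExt.{u} C) {a b : C.Cell} (p : Γ.Term a b) :
    Term.Rel (Γ.fout (Γ.fmk p)).2.2 p := fmk_eq.1 (Γ.fmk_fout _)

def fsrc (Γ : CellExt.{u} C) (i : Fin (n + 1)) (x : Γ.FCell) : Γ.FCell :=
  Fin.lastCases (motive := fun _ => Γ.FCell) (Γ.fid (Γ.fdom x))
    (fun j => Γ.fid (C.src j (Γ.fdom x))) i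

def ftgt (Γ : CellExt.{u} C) (i : Fin (n + 1)) (x : Γ.FCell) : Γ.FCell :=
  Fin.lastCases (motive := fun _ => Γ.FCell) (Γ.fid (Γ.fcod x))
    (fun j => Γ.fid (C.tgt j (Γ.fcod x))) i

section

variable (Γ : CellExt.{u} C) {a b : C.Cell} (p : Γ.Term a b)

theorem fsrc_last : Γ.fsrc (Fin.last n) (Γ.fmk p) = Γ.fid a := by
  simp [fsrc, fdom_fmk]

theorem ftgt_last : Γ.ftgt (Fin.last n) (Γ.fmk p) = Γ.fid b := by
  simp [ftgt, fcod_fmk]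

theorem fsrc_castSucc (j : Fin n) :
    Γ.fsrc j.castSucc (Γ.fmk p) = Γ.fid (C.src j a) := by
  simp [fsrc, fdom_fmk]

theorem ftgt_castSucc (j : Fin n) :
    Γ.ftgt j.castSucc (Γ.fmk p) = Γ.fid (C.tgt j b) := by
  simp [ftgt, fcod_fmk]

theorem fsrc_last_fid : Γ.fsrc (Fin.last n) (Γ.fid a) = Γ.fid a := Γ.fsrc_last _

theorem ftgt_last_fid : Γ.ftgt (Fin.last n) (Γ.fid a) = Γ.fid a := Γ.ftgt_last _

theorem fsrc_castSucc_fid (j : Fin n) :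
    Γ.fsrc j.castSucc (Γ.fid a) = Γ.fid (C.src j a) := Γ.fsrc_castSucc _ j

theorem ftgt_castSucc_fid (j : Fin n) :
    Γ.ftgt j.castSucc (Γ.fid a) = Γ.fid (C.tgt j a) := Γ.ftgt_castSucc _ j

end

theorem cond_last {Γ : CellExt.{u} C} {a b c d : C.Cell} {p : Γ.Term a b} {q : Γ.Term c d}
    (h : Γ.ftgt (Fin.last n) (Γ.fmk p) = Γ.fsrc (Fin.last n) (Γ.fmk q)) : b = c := by
  rw [ftgt_last, fsrc_last] at h
  exact fid_inj h

theorem cond_low {Γ : CellExt.{u} C} {a b c d : C.Cell} {p : Γ.Term a b} {q : Γ.Term c d}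
    {j : Fin n} (h : Γ.ftgt j.castSucc (Γ.fmk p) = Γ.fsrc j.castSucc (Γ.fmk q)) :
    C.tgt j a = C.src j c ∧ C.tgt j b = C.src j d := by
  rw [ftgt_castSucc, fsrc_castSucc] at h
  have := fid_inj h
  rw [(p.parallel j).2, ← (q.parallel j).1]
  exact ⟨this, this⟩

theorem cond_fout {Γ : CellExt.{u} C} {x y : Γ.FCell} {i : Fin (n + 1)}
    (h : Γ.ftgt i x = Γ.fsrc i y) :
    Γ.ftgt i (Γ.fmk (Γ.fout x).2.2) = Γ.fsrc i (Γ.fmk (Γ.fout y).2.2) := by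
  rw [fmk_fout, fmk_fout, h]

def fcomp (Γ : CellExt.{u} C) (i : Fin (n + 1)) (x y : Γ.FCell) (h : Γ.ftgt i x = Γ.fsrc i y) :
    Γ.FCell :=
  Fin.lastCases (motive := fun i => Γ.ftgt i x = Γ.fsrc i y → Γ.FCell)
    (fun h => Γ.fmk (Term.topH (Γ.fout x).2.2 (Γ.fout y).2.2 (cond_last (cond_fout h))))
    (fun j h => Γ.fmk (Term.low j (Γ.fout x).2.2 (Γ.fout y).2.2 (cond_low (cond_fout h)).1
      (cond_low (cond_fout h)).2)) i h

theorem fcomp_last (Γ : CellExt.{u} C) {a b c : C.Cell} (p : Γ.Term a b) (q : Γ.Term b c) (h) :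
    Γ.fcomp (Fin.last n) (Γ.fmk p) (Γ.fmk q) h = Γ.fmk (.top p q) := by
  simp only [fcomp, Fin.lastCases_last]
  exact fmk_eq.2 (Term.topH_congr _ rfl (Γ.fout_fmk p) (Γ.fout_fmk q))

theorem fcomp_castSucc (Γ : CellExt.{u} C) {a b c d : C.Cell} (p : Γ.Term a b) (q : Γ.Term c d)
    (j : Fin n) (h) : Γ.fcomp j.castSucc (Γ.fmk p) (Γ.fmk q) h =
      Γ.fmk (.low j p q (cond_low h).1 (cond_low h).2) := by
  simp only [fcomp, Fin.lastCases_castSucc]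
  exact fmk_eq.2 (.low_congr j _ _ _ _ (Γ.fout_fmk p) (Γ.fout_fmk q))

theorem cond_fid {Γ : CellExt.{u} C} {a c : C.Cell} {j : Fin n}
    (h : Γ.ftgt j.castSucc (Γ.fid a) = Γ.fsrc j.castSucc (Γ.fid c)) : C.tgt j a = C.src j c :=
  (cond_low (p := .id a) (q := .id c) h).1

theorem fcomp_fid (Γ : CellExt.{u} C) (a c : C.Cell) (j : Fin n) (h) :
    Γ.fcomp j.castSucc (Γ.fid a) (Γ.fid c) h = Γ.fid (C.comp j a c (cond_fid h)) :=
  (Γ.fcomp_castSucc (.id a) (.id c) j h).trans (fmk_eq.2 (.low_id_id j a c _ _))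

theorem fcomp_id_last (Γ : CellExt.{u} C) {a b : C.Cell} (p : Γ.Term a b) (h) :
    Γ.fcomp (Fin.last n) (Γ.fid a) (Γ.fmk p) h = Γ.fmk p :=
  (Γ.fcomp_last (.id a) p h).trans (fmk_eq.2 (.id_top p))

theorem fcomp_last_id (Γ : CellExt.{u} C) {a b : C.Cell} (p : Γ.Term a b) (h) :
    Γ.fcomp (Fin.last n) (Γ.fmk p) (Γ.fid b) h = Γ.fmk p :=
  (Γ.fcomp_last p (.id b) h).trans (fmk_eq.2 (.top_id p))

theorem fcomp_id_castSucc (Γ : CellExt.{u} C) {a b : C.Cell} (p : Γ.Term a b) (j : Fin n) (h) :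
    Γ.fcomp j.castSucc (Γ.fid (C.src j a)) (Γ.fmk p) h = Γ.fmk p :=
  (Γ.fcomp_castSucc (.id _) p j h).trans (fmk_eq.2 (.id_low j p _ _))

theorem fcomp_castSucc_id (Γ : CellExt.{u} C) {a b : C.Cell} (p : Γ.Term a b) (j : Fin n) (h) :
    Γ.fcomp j.castSucc (Γ.fmk p) (Γ.fid (C.tgt j a)) h = Γ.fmk p :=
  (Γ.fcomp_castSucc p (.id _) j h).trans (fmk_eq.2 (.low_id j p _ _))

/-- The free `(n+1)`-category `C[Γ]` generated by a cellular extension `Γ` of `C`. -/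
def free (Γ : CellExt.{u} C) : NCat.{u} (n + 1) where
  Cell := Γ.FCell
  src := Γ.fsrc
  tgt := Γ.ftgt
  comp := Γ.fcomp
  src_src_of_le {i j} h x := by
    obtain ⟨a, b, p, rfl⟩ := Γ.fmk_surj x
    induction i using Fin.lastCases <;> induction j using Fin.lastCases
    · simp only [fsrc_last, fsrc_last_fid, ftgt_last_fid, fsrc_castSucc_fid, ftgt_castSucc_fid]
    · simp only [fsrc_last, fsrc_castSucc, fsrc_last_fid, ftgt_last_fid, fsrc_castSucc_fid, ftgt_castSucc_fid]
    · exact absurd (Fin.castSucc_lt_last _) (not_lt.2 h)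
    · simp only [fsrc_castSucc, C.src_src_of_le (Fin.castSucc_le_castSucc_iff.1 h), fsrc_last_fid, ftgt_last_fid, fsrc_castSucc_fid, ftgt_castSucc_fid]
  tgt_src_of_le {i j} h x := by
    obtain ⟨a, b, p, rfl⟩ := Γ.fmk_surj x
    induction i using Fin.lastCases <;> induction j using Fin.lastCases
    · simp only [fsrc_last, ftgt_last, fsrc_last_fid, ftgt_last_fid, fsrc_castSucc_fid, ftgt_castSucc_fid]
    · simp only [ftgt_last, fsrc_castSucc, fsrc_last_fid, ftgt_last_fid, fsrc_castSucc_fid, ftgt_castSucc_fid]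
    · exact absurd (Fin.castSucc_lt_last _) (not_lt.2 h)
    · simp only [fsrc_castSucc, ftgt_castSucc, C.tgt_src_of_le (Fin.castSucc_le_castSucc_iff.1 h), fsrc_last_fid, ftgt_last_fid, fsrc_castSucc_fid, ftgt_castSucc_fid]
  src_tgt_of_le {i j} h x := by
    obtain ⟨a, b, p, rfl⟩ := Γ.fmk_surj x
    induction i using Fin.lastCases <;> induction j using Fin.lastCases
    · simp only [fsrc_last, ftgt_last, fsrc_last_fid, ftgt_last_fid, fsrc_castSucc_fid, ftgt_castSucc_fid]
    · simp only [fsrc_last, ftgt_castSucc, fsrc_last_fid, ftgt_last_fid, fsrc_castSucc_fid, ftgt_castSucc_fid]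
    · exact absurd (Fin.castSucc_lt_last _) (not_lt.2 h)
    · simp only [fsrc_castSucc, ftgt_castSucc, C.src_tgt_of_le (Fin.castSucc_le_castSucc_iff.1 h), fsrc_last_fid, ftgt_last_fid, fsrc_castSucc_fid, ftgt_castSucc_fid]
  tgt_tgt_of_le {i j} h x := by
    obtain ⟨a, b, p, rfl⟩ := Γ.fmk_surj x
    induction i using Fin.lastCases <;> induction j using Fin.lastCases
    · simp only [ftgt_last, fsrc_last_fid, ftgt_last_fid, fsrc_castSucc_fid, ftgt_castSucc_fid]
    · simp only [ftgt_last, ftgt_castSucc, fsrc_last_fid, ftgt_last_fid, fsrc_castSucc_fid, ftgt_castSucc_fid]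
    · exact absurd (Fin.castSucc_lt_last _) (not_lt.2 h)
    · simp only [ftgt_castSucc, C.tgt_tgt_of_le (Fin.castSucc_le_castSucc_iff.1 h), fsrc_last_fid, ftgt_last_fid, fsrc_castSucc_fid, ftgt_castSucc_fid]
  src_src_of_lt {i j} h x := by
    obtain ⟨a, b, p, rfl⟩ := Γ.fmk_surj x
    induction i using Fin.lastCases with
    | last => exact absurd h (not_lt.2 (Fin.le_last _))
    | cast i =>
      induction j using Fin.lastCases
      · simp only [fsrc_castSucc, fsrc_last, fsrc_last_fid, ftgt_last_fid, fsrc_castSucc_fid, ftgt_castSucc_fid]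
      · simp only [fsrc_castSucc, C.src_src_of_lt (Fin.castSucc_lt_castSucc_iff.1 h), fsrc_last_fid, ftgt_last_fid, fsrc_castSucc_fid, ftgt_castSucc_fid]
  src_tgt_of_lt {i j} h x := by
    obtain ⟨a, b, p, rfl⟩ := Γ.fmk_surj x
    induction i using Fin.lastCases with
    | last => exact absurd h (not_lt.2 (Fin.le_last _))
    | cast i =>
      induction j using Fin.lastCases
      · simp only [fsrc_castSucc, ftgt_last, (p.parallel i).1, fsrc_last_fid, ftgt_last_fid, fsrc_castSucc_fid, ftgt_castSucc_fid]
      · simp only [fsrc_castSucc, ftgt_castSucc, C.src_tgt_of_lt (Fin.castSucc_lt_castSucc_iff.1 h),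
          (p.parallel i).1, fsrc_last_fid, ftgt_last_fid, fsrc_castSucc_fid, ftgt_castSucc_fid]
  tgt_src_of_lt {i j} h x := by
    obtain ⟨a, b, p, rfl⟩ := Γ.fmk_surj x
    induction i using Fin.lastCases with
    | last => exact absurd h (not_lt.2 (Fin.le_last _))
    | cast i =>
      induction j using Fin.lastCases
      · simp only [ftgt_castSucc, fsrc_last, (p.parallel i).2, fsrc_last_fid, ftgt_last_fid, fsrc_castSucc_fid, ftgt_castSucc_fid]
      · simp only [fsrc_castSucc, ftgt_castSucc, C.tgt_src_of_lt (Fin.castSucc_lt_castSucc_iff.1 h),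
          (p.parallel i).2, fsrc_last_fid, ftgt_last_fid, fsrc_castSucc_fid, ftgt_castSucc_fid]
  tgt_tgt_of_lt {i j} h x := by
    obtain ⟨a, b, p, rfl⟩ := Γ.fmk_surj x
    induction i using Fin.lastCases with
    | last => exact absurd h (not_lt.2 (Fin.le_last _))
    | cast i =>
      induction j using Fin.lastCases
      · simp only [ftgt_castSucc, ftgt_last, fsrc_last_fid, ftgt_last_fid, fsrc_castSucc_fid, ftgt_castSucc_fid]
      · simp only [ftgt_castSucc, C.tgt_tgt_of_lt (Fin.castSucc_lt_castSucc_iff.1 h), fsrc_last_fid, ftgt_last_fid, fsrc_castSucc_fid, ftgt_castSucc_fid]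
  src_comp i x y h := by
    obtain ⟨a, b, p, rfl⟩ := Γ.fmk_surj x
    obtain ⟨c, d, q, rfl⟩ := Γ.fmk_surj y
    induction i using Fin.lastCases with
    | last =>
      obtain rfl := cond_last h
      simp only [fcomp_last, fsrc_last]
    | cast i => simp only [fcomp_castSucc, fsrc_castSucc, C.src_comp]
  tgt_comp i x y h := by
    obtain ⟨a, b, p, rfl⟩ := Γ.fmk_surj x
    obtain ⟨c, d, q, rfl⟩ := Γ.fmk_surj y
    induction i using Fin.lastCases with
    | last =>
      obtain rfl := cond_last h
      simp only [fcomp_last, ftgt_last]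
    | cast i => simp only [fcomp_castSucc, ftgt_castSucc, C.tgt_comp]
  src_comp_of_lt {i j} hij x y h h' := by
    obtain ⟨a, b, p, rfl⟩ := Γ.fmk_surj x
    obtain ⟨c, d, q, rfl⟩ := Γ.fmk_surj y
    induction i using Fin.lastCases with
    | last => exact absurd hij (not_lt.2 (Fin.le_last _))
    | cast i =>
      induction j using Fin.lastCases with
      | last =>
        simp only [fcomp_castSucc, fsrc_last, fcomp_fid]
      | cast j =>
        simp only [fcomp_castSucc, fsrc_castSucc, fcomp_fid]
        exact congrArg Γ.fid (C.src_comp_of_lt (Fin.castSucc_lt_castSucc_iff.1 hij) _ _ _ _)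
  tgt_comp_of_lt {i j} hij x y h h' := by
    obtain ⟨a, b, p, rfl⟩ := Γ.fmk_surj x
    obtain ⟨c, d, q, rfl⟩ := Γ.fmk_surj y
    induction i using Fin.lastCases with
    | last => exact absurd hij (not_lt.2 (Fin.le_last _))
    | cast i =>
      induction j using Fin.lastCases with
      | last =>
        simp only [fcomp_castSucc, ftgt_last, fcomp_fid]
      | cast j =>
        simp only [fcomp_castSucc, ftgt_castSucc, fcomp_fid]
        exact congrArg Γ.fid (C.tgt_comp_of_lt (Fin.castSucc_lt_castSucc_iff.1 hij) _ _ _ _)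
  id_comp i x h := by
    obtain ⟨a, b, p, rfl⟩ := Γ.fmk_surj x
    induction i using Fin.lastCases with
    | last =>
      simp only [fsrc_last, fcomp_id_last]
    | cast i =>
      simp only [fsrc_castSucc, fcomp_id_castSucc]
  comp_id i x h := by
    obtain ⟨a, b, p, rfl⟩ := Γ.fmk_surj x
    induction i using Fin.lastCases with
    | last =>
      simp only [ftgt_last, fcomp_last_id]
    | cast i =>
      simp only [ftgt_castSucc, ← (p.parallel i).2, fcomp_castSucc_id]
  assoc i x y z h₁ h₂ h₃ h₄ := by
    obtain ⟨a, b, p, rfl⟩ := Γ.fmk_surj x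
    obtain ⟨c, d, q, rfl⟩ := Γ.fmk_surj y
    obtain ⟨e, f, r, rfl⟩ := Γ.fmk_surj z
    induction i using Fin.lastCases with
    | last =>
      obtain rfl := cond_last h₁
      obtain rfl := cond_last h₃
      simp only [fcomp_last]
      exact fmk_eq.2 (.top_assoc p q r)
    | cast i =>
      simp only [fcomp_castSucc]
      exact fmk_eq.2 (.low_assoc i p q r _ _ _ _ _ _ _ _)
  exchange {i j} hij x y z w h₁ h₂ h₃ h₄ h₅ h₆ := by
    obtain ⟨a, b, p, rfl⟩ := Γ.fmk_surj x
    obtain ⟨c, d, q, rfl⟩ := Γ.fmk_surj y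
    obtain ⟨a', b', p', rfl⟩ := Γ.fmk_surj z
    obtain ⟨c', d', q', rfl⟩ := Γ.fmk_surj w
    induction i using Fin.lastCases with
    | last => exact absurd hij (not_lt.2 (Fin.le_last _))
    | cast i =>
      induction j using Fin.lastCases with
      | last =>
        obtain rfl := cond_last h₁
        obtain rfl := cond_last h₂
        simp only [fcomp_last, fcomp_castSucc]
        exact fmk_eq.2 (.exchange_top i p q p' q' _ _ _)
      | cast j =>
        simp only [fcomp_castSucc]
        exact fmk_eq.2 (.exchange_low (Fin.castSucc_lt_castSucc_iff.1 hij) p q p' q'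
          _ _ _ _ _ _ _ _ _ _ _ _)

end CellExt

/-! ### Functors and quotients -/

namespace NFunctor

variable {n : ℕ} {C D : NCat.{u} n}

theorem map_parallel (F : NFunctor C D) {x y : C.Cell} (h : C.Parallel x y) :
    D.Parallel (F.map x) (F.map y) := by
  intro i
  rw [← F.map_src, ← F.map_src, ← F.map_tgt, ← F.map_tgt, (h i).1, (h i).2]
  exact ⟨rfl, rfl⟩

theorem map_cong (F : NFunctor C D) {Γ : CellExt.{u} C} {Δ : CellExt.{u} D}
    (hF : ∀ γ, Δ.Cong (F.map (Γ.s γ)) (F.map (Γ.t γ))) {x y : C.Cell} (h : Γ.Cong x y) :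
    Δ.Cong (F.map x) (F.map y) := by
  induction h with
  | gen γ => exact hF γ
  | refl x => exact .refl _
  | symm _ ih => exact ih.symm
  | trans _ _ ih₁ ih₂ => exact ih₁.trans ih₂
  | comp i h h' _ _ ih₁ ih₂ =>
    rw [F.map_comp i _ _ h (F.cond h), F.map_comp i _ _ h' (F.cond h')]
    exact .comp i _ _ ih₁ ih₂

/-- The map induced on quotients by a functor compatible with the generating relations. -/
def qmap (F : NFunctor C D) (Γ : CellExt.{u} C) (Δ : CellExt.{u} D) (p : Γ.QCell) : Δ.QCell :=
  Δ.cls (F.map (Γ.qout p))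

theorem qmap_cls (F : NFunctor C D) {Γ : CellExt.{u} C} {Δ : CellExt.{u} D}
    (hF : ∀ γ, Δ.Cong (F.map (Γ.s γ)) (F.map (Γ.t γ))) (x : C.Cell) :
    F.qmap Γ Δ (Γ.cls x) = Δ.cls (F.map x) :=
  CellExt.cls_eq.2 (F.map_cong hF (CellExt.cls_eq.1 (Γ.cls_qout _)))

/-- The functor induced on quotients by a functor compatible with the generating relations. -/
def onQuotient (F : NFunctor C D) (Γ : CellExt.{u} C) (Δ : CellExt.{u} D)
    (hF : ∀ γ, Δ.Cong (F.map (Γ.s γ)) (F.map (Γ.t γ))) : NFunctor Γ.quotient Δ.quotient where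
  map := F.qmap Γ Δ
  map_src i p := by
    obtain ⟨x, rfl⟩ := Γ.cls_surj p
    change F.qmap Γ Δ (Γ.qsrc i (Γ.cls x)) = Δ.qsrc i (F.qmap Γ Δ (Γ.cls x))
    rw [Γ.qsrc_cls, F.qmap_cls hF, F.qmap_cls hF, Δ.qsrc_cls, F.map_src]
  map_tgt i p := by
    obtain ⟨x, rfl⟩ := Γ.cls_surj p
    change F.qmap Γ Δ (Γ.qtgt i (Γ.cls x)) = Δ.qtgt i (F.qmap Γ Δ (Γ.cls x))
    rw [Γ.qtgt_cls, F.qmap_cls hF, F.qmap_cls hF, Δ.qtgt_cls, F.map_tgt]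
  map_comp i p q h h' := by
    obtain ⟨x, rfl⟩ := Γ.cls_surj p
    obtain ⟨y, rfl⟩ := Γ.cls_surj q
    have hx := CellExt.cond_of_cls h
    have e := Γ.qcomp_cls i x y h
    have e' := Δ.quotient.comp_congr (h := h') (F.qmap_cls hF x) (F.qmap_cls hF y)
    refine (congrArg (F.qmap Γ Δ) e).trans ((F.qmap_cls hF _).trans (Eq.trans ?_ e'.symm))
    exact (congrArg Δ.cls (F.map_comp i x y hx (F.cond hx))).trans
      (Δ.qcomp_cls i (F.map x) (F.map y) (by rw [Δ.qtgt_cls, Δ.qsrc_cls, F.cond hx])).symm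

end NFunctor

/-! ### Track categories -/

namespace NCat

variable {n : ℕ}

/-- The source `n`-cell of an `(n+1)`-cell. -/
abbrev dom (T : NCat.{u} (n + 1)) (f : T.Cell) : T.Cell := T.src (Fin.last n) f

/-- The target `n`-cell of an `(n+1)`-cell. -/
abbrev cod (T : NCat.{u} (n + 1)) (f : T.Cell) : T.Cell := T.tgt (Fin.last n) f

/-- The composite `f ⋆_n g` of `(n+1)`-cells. -/
abbrev star (T : NCat.{u} (n + 1)) (f g : T.Cell) (h : T.cod f = T.dom g) : T.Cell :=
  T.comp (Fin.last n) f g h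

/-- `g` is an inverse of the `(n+1)`-cell `f`. -/
def IsInverse (T : NCat.{u} (n + 1)) (f g : T.Cell) : Prop :=
  ∃ (h : T.cod f = T.dom g) (h' : T.cod g = T.dom f),
    T.star f g h = T.dom f ∧ T.star g f h' = T.cod f

/-- A track `(n+1)`-category: all the `(n+1)`-cells are invertible. -/
def IsTrack (T : NCat.{u} (n + 1)) : Prop := ∀ f, ∃ g, T.IsInverse f g

/-- The inverse `f⁻` of an `(n+1)`-cell of a track `(n+1)`-category. -/
def inv (T : NCat.{u} (n + 1)) (hT : T.IsTrack) (f : T.Cell) : T.Cell := (hT f).choose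

theorem isInverse_inv (T : NCat.{u} (n + 1)) (hT : T.IsTrack) (f : T.Cell) :
    T.IsInverse f (T.inv hT f) := (hT f).choose_spec

theorem dom_inv (T : NCat.{u} (n + 1)) (hT : T.IsTrack) (f : T.Cell) :
    T.dom (T.inv hT f) = T.cod f := (T.isInverse_inv hT f).choose.symm

theorem cod_inv (T : NCat.{u} (n + 1)) (hT : T.IsTrack) (f : T.Cell) :
    T.cod (T.inv hT f) = T.dom f := (T.isInverse_inv hT f).choose_spec.choose

theorem star_inv (T : NCat.{u} (n + 1)) (hT : T.IsTrack) (f : T.Cell) (h) :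
    T.star f (T.inv hT f) h = T.dom f := (T.isInverse_inv hT f).choose_spec.choose_spec.1

theorem inv_star (T : NCat.{u} (n + 1)) (hT : T.IsTrack) (f : T.Cell) (h) :
    T.star (T.inv hT f) f h = T.cod f := (T.isInverse_inv hT f).choose_spec.choose_spec.2

theorem src_dom (T : NCat.{u} (n + 1)) (i : Fin n) (f : T.Cell) :
    T.src i.castSucc (T.dom f) = T.src i.castSucc f := T.src_src_of_lt (Fin.castSucc_lt_last i) f

theorem src_cod (T : NCat.{u} (n + 1)) (i : Fin n) (f : T.Cell) :
    T.src i.castSucc (T.cod f) = T.src i.castSucc f := T.src_tgt_of_lt (Fin.castSucc_lt_last i) f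

theorem tgt_dom (T : NCat.{u} (n + 1)) (i : Fin n) (f : T.Cell) :
    T.tgt i.castSucc (T.dom f) = T.tgt i.castSucc f := T.tgt_src_of_lt (Fin.castSucc_lt_last i) f

theorem tgt_cod (T : NCat.{u} (n + 1)) (i : Fin n) (f : T.Cell) :
    T.tgt i.castSucc (T.cod f) = T.tgt i.castSucc f := T.tgt_tgt_of_lt (Fin.castSucc_lt_last i) f

theorem dom_dom (T : NCat.{u} (n + 1)) (f : T.Cell) : T.dom (T.dom f) = T.dom f :=
  T.src_src_of_le le_rfl f

theorem cod_dom (T : NCat.{u} (n + 1)) (f : T.Cell) : T.cod (T.dom f) = T.dom f :=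
  T.tgt_src_of_le le_rfl f

theorem dom_cod (T : NCat.{u} (n + 1)) (f : T.Cell) : T.dom (T.cod f) = T.cod f :=
  T.src_tgt_of_le le_rfl f

theorem cod_cod (T : NCat.{u} (n + 1)) (f : T.Cell) : T.cod (T.cod f) = T.cod f :=
  T.tgt_tgt_of_le le_rfl f

theorem dom_star (T : NCat.{u} (n + 1)) (f g : T.Cell) (h) : T.dom (T.star f g h) = T.dom f :=
  T.src_comp _ f g h

theorem cod_star (T : NCat.{u} (n + 1)) (f g : T.Cell) (h) : T.cod (T.star f g h) = T.cod g :=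
  T.tgt_comp _ f g h

theorem dom_star_id (T : NCat.{u} (n + 1)) (f : T.Cell) (h) : T.star (T.dom f) f h = f :=
  T.id_comp _ f h

theorem star_cod_id (T : NCat.{u} (n + 1)) (f : T.Cell) (h) : T.star f (T.cod f) h = f :=
  T.comp_id _ f h

theorem cond_dom (T : NCat.{u} (n + 1)) {i : Fin n} {f g : T.Cell}
    (h : T.tgt i.castSucc f = T.src i.castSucc g) :
    T.tgt i.castSucc (T.dom f) = T.src i.castSucc (T.dom g) := by rw [tgt_dom, src_dom, h]

theorem cond_cod (T : NCat.{u} (n + 1)) {i : Fin n} {f g : T.Cell}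
    (h : T.tgt i.castSucc f = T.src i.castSucc g) :
    T.tgt i.castSucc (T.cod f) = T.src i.castSucc (T.cod g) := by rw [tgt_cod, src_cod, h]

theorem dom_comp (T : NCat.{u} (n + 1)) (i : Fin n) (f g : T.Cell) (h) :
    T.dom (T.comp i.castSucc f g h) = T.comp i.castSucc (T.dom f) (T.dom g) (T.cond_dom h) :=
  T.src_comp_of_lt (Fin.castSucc_lt_last i) f g h _

theorem cod_comp (T : NCat.{u} (n + 1)) (i : Fin n) (f g : T.Cell) (h) :
    T.cod (T.comp i.castSucc f g h) = T.comp i.castSucc (T.cod f) (T.cod g) (T.cond_cod h) :=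
  T.tgt_comp_of_lt (Fin.castSucc_lt_last i) f g h _

theorem src_star (T : NCat.{u} (n + 1)) (i : Fin n) (f g : T.Cell) (h) :
    T.src i.castSucc (T.star f g h) = T.src i.castSucc f :=
  T.src_comp_of_gt (Fin.castSucc_lt_last i) f g h

theorem tgt_star (T : NCat.{u} (n + 1)) (i : Fin n) (f g : T.Cell) (h) :
    T.tgt i.castSucc (T.star f g h) = T.tgt i.castSucc g :=
  T.tgt_comp_of_gt (Fin.castSucc_lt_last i) f g h

theorem isInverse_dom (T : NCat.{u} (n + 1)) (f : T.Cell) : T.IsInverse (T.dom f) (T.dom f) := by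
  have h : T.cod (T.dom f) = T.dom (T.dom f) := by rw [cod_dom, dom_dom]
  have e : T.star (T.dom f) (T.dom f) h = T.dom f := by
    exact (T.comp_congr (T.dom_dom f).symm rfl).trans (T.dom_star_id (T.dom f) (T.cod_dom (T.dom f)))
  exact ⟨h, h, e.trans (T.dom_dom f).symm, e.trans (T.cod_dom f).symm⟩

theorem IsInverse.star {T : NCat.{u} (n + 1)} {f f' g g' : T.Cell} (hf : T.IsInverse f f')
    (hg : T.IsInverse g g') (h : T.cod f = T.dom g) (h' : T.cod g' = T.dom f') :
    T.IsInverse (T.star f g h) (T.star g' f' h') := by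
  obtain ⟨a, b, c, d⟩ := hf
  obtain ⟨a', b', c', d'⟩ := hg
  refine ⟨by rw [cod_star, dom_star, a'], by rw [cod_star, dom_star, b], ?_, ?_⟩
  · have h₁ : T.cod g = T.dom (T.star g' f' h') := by rw [dom_star, a']
    have h₂ : T.cod f = T.dom (T.star g (T.star g' f' h') h₁) := by rw [dom_star, h]
    have h₃ : T.cod (T.star g g' a') = T.dom f' := by rw [cod_star, h']
    refine (T.assoc _ _ _ _ _ _ h₁ h₂).trans ?_
    refine (T.comp_congr rfl (T.assoc _ _ _ _ a' h₃ _ _).symm).trans ?_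
    refine (T.comp_congr rfl ((T.comp_congr (c'.trans (h.symm.trans a)) rfl).trans
      (T.dom_star_id f' (T.cod_dom f')))).trans ?_
    exact c.trans (T.dom_star _ _ _).symm
  · have h₁ : T.cod f' = T.dom (T.star f g h) := by rw [dom_star, b]
    have h₂ : T.cod g' = T.dom (T.star f' (T.star f g h) h₁) := by rw [dom_star, h']
    have h₃ : T.cod (T.star f' f b) = T.dom g := by rw [cod_star, h]
    refine (T.assoc _ _ _ _ _ _ h₁ h₂).trans ?_
    refine (T.comp_congr rfl (T.assoc _ _ _ _ b h₃ _ _).symm).trans ?_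
    refine (T.comp_congr rfl ((T.comp_congr (d.trans h) rfl).trans
      (T.dom_star_id g (T.cod_dom g)))).trans ?_
    exact d'.trans (T.cod_star _ _ _).symm

/-- The exchange relation between `⋆_i`, `i < n`, and `⋆_n`. -/
theorem comp_star_star (T : NCat.{u} (n + 1)) (i : Fin n) {f f' g g' : T.Cell}
    (h₁ : T.cod f = T.dom f') (h₂ : T.cod g = T.dom g')
    (h : T.tgt i.castSucc f = T.src i.castSucc g)
    (h' : T.tgt i.castSucc f' = T.src i.castSucc g') (h₃ h₄) :
    T.comp i.castSucc (T.star f f' h₁) (T.star g g' h₂) h₃ =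
      T.star (T.comp i.castSucc f g h) (T.comp i.castSucc f' g' h') h₄ :=
  T.exchange (Fin.castSucc_lt_last i) _ _ _ _ _ _ _ _ _ _

theorem cond_comp_comp (T : NCat.{u} (n + 1)) (i : Fin n) {f f' g g' : T.Cell}
    (h₁ : T.cod f = T.dom f') (h₂ : T.cod g = T.dom g')
    (h : T.tgt i.castSucc f = T.src i.castSucc g)
    (h' : T.tgt i.castSucc f' = T.src i.castSucc g') :
    T.cod (T.comp i.castSucc f g h) = T.dom (T.comp i.castSucc f' g' h') := by
  rw [cod_comp, dom_comp]
  exact T.comp_congr h₁ h₂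

theorem cond_star_star (T : NCat.{u} (n + 1)) (i : Fin n) {f f' g g' : T.Cell}
    (h₁ : T.cod f = T.dom f') (h₂ : T.cod g = T.dom g')
    (h : T.tgt i.castSucc f = T.src i.castSucc g) :
    T.tgt i.castSucc (T.star f f' h₁) = T.src i.castSucc (T.star g g' h₂) := by
  rw [tgt_star, src_star, ← tgt_dom, ← h₁, tgt_cod, h]

theorem IsInverse.comp {T : NCat.{u} (n + 1)} {f f' g g' : T.Cell} (hf : T.IsInverse f f')
    (hg : T.IsInverse g g') (i : Fin n) (h : T.tgt i.castSucc f = T.src i.castSucc g)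
    (h' : T.tgt i.castSucc f' = T.src i.castSucc g') :
    T.IsInverse (T.comp i.castSucc f g h) (T.comp i.castSucc f' g' h') := by
  obtain ⟨a, b, c, d⟩ := hf
  obtain ⟨a', b', c', d'⟩ := hg
  refine ⟨T.cond_comp_comp i a a' h h', T.cond_comp_comp i b b' h' h, ?_, ?_⟩
  · rw [dom_comp, ← T.comp_star_star i a a' h h' (T.cond_star_star i a a' h)]
    exact T.comp_congr c c'
  · rw [cod_comp, ← T.comp_star_star i b b' h' h (T.cond_star_star i b b' h')]
    exact T.comp_congr d d'

end NCat

namespace CellExt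

variable {n : ℕ}

theorem quotient_isInverse {T : NCat.{u} (n + 1)} (Γ : CellExt.{u} T) {f g : T.Cell}
    (h : T.cod f = T.dom g) (h' : T.cod g = T.dom f) (e : Γ.Cong (T.star f g h) (T.dom f))
    (e' : Γ.Cong (T.star g f h') (T.cod f)) : Γ.quotient.IsInverse (Γ.cls f) (Γ.cls g) := by
  have k : Γ.qtgt (Fin.last n) (Γ.cls f) = Γ.qsrc (Fin.last n) (Γ.cls g) := by
    rw [qtgt_cls, qsrc_cls]; exact congrArg Γ.cls h
  have k' : Γ.qtgt (Fin.last n) (Γ.cls g) = Γ.qsrc (Fin.last n) (Γ.cls f) := by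
    rw [qtgt_cls, qsrc_cls]; exact congrArg Γ.cls h'
  refine ⟨k, k', ?_, ?_⟩
  · change Γ.qcomp _ _ _ k = Γ.qsrc _ _
    rw [qcomp_cls, qsrc_cls]
    exact cls_eq.2 e
  · change Γ.qcomp _ _ _ k' = Γ.qtgt _ _
    rw [qcomp_cls, qtgt_cls]
    exact cls_eq.2 e'

theorem quotient_isTrack {T : NCat.{u} (n + 1)} (hT : T.IsTrack) (Γ : CellExt.{u} T) :
    Γ.quotient.IsTrack := by
  intro p
  obtain ⟨f, rfl⟩ := Γ.cls_surj p
  obtain ⟨g, h, h', e, e'⟩ := hT f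
  exact ⟨Γ.cls g, Γ.quotient_isInverse h h' (e ▸ .refl _) (e' ▸ .refl _)⟩

variable {C : NCat.{u} n}

/-- The cellular extension `Γ, Γ⁻`: `Sum.inl γ` is `γ`, and `Sum.inr γ` is the formal inverse
`γ⁻`, with source and target exchanged. -/
def double (Γ : CellExt.{u} C) : CellExt.{u} C where
  Gen := Γ.Gen ⊕ Γ.Gen
  s := Sum.elim Γ.s Γ.t
  t := Sum.elim Γ.t Γ.s
  parallel γ := by
    cases γ with
    | inl γ => exact Γ.parallel γ
    | inr γ => exact (Γ.parallel γ).symm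

/-- The generator `γ` of `C[Γ, Γ⁻]`. -/
def pos (Γ : CellExt.{u} C) (γ : Γ.Gen) : Γ.double.Term (Γ.s γ) (Γ.t γ) :=
  .gen (Γ := Γ.double) (Sum.inl γ)

/-- The generator `γ⁻` of `C[Γ, Γ⁻]`. -/
def neg (Γ : CellExt.{u} C) (γ : Γ.Gen) : Γ.double.Term (Γ.t γ) (Γ.s γ) :=
  .gen (Γ := Γ.double) (Sum.inr γ)

theorem free_parallel (Γ : CellExt.{u} C) {a b : C.Cell} (p q : Γ.Term a b) :
    Γ.free.Parallel (Γ.fmk p) (Γ.fmk q) := by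
  intro i
  change Γ.fsrc i _ = Γ.fsrc i _ ∧ Γ.ftgt i _ = Γ.ftgt i _
  induction i using Fin.lastCases with
  | last => simp only [fsrc_last, ftgt_last, and_self]
  | cast i => simp only [fsrc_castSucc, ftgt_castSucc, and_self]

/-- The relations `γ ⋆_n γ⁻ = 1_{s γ}` (`Sum.inl γ`) and `γ⁻ ⋆_n γ = 1_{t γ}` (`Sum.inr γ`). -/
def invRel (Γ : CellExt.{u} C) : CellExt.{u} Γ.double.free where
  Gen := Γ.Gen ⊕ Γ.Gen
  s := Sum.elim (fun γ => Γ.double.fmk (.top (Γ.pos γ) (Γ.neg γ)))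
    (fun γ => Γ.double.fmk (.top (Γ.neg γ) (Γ.pos γ)))
  t := Sum.elim (fun γ => Γ.double.fid (Γ.s γ)) (fun γ => Γ.double.fid (Γ.t γ))
  parallel γ := by
    cases γ <;> exact Γ.double.free_parallel _ _

/-- The track `(n+1)`-category `C(Γ)` generated by a cellular extension `Γ` of an `n`-category. -/
def freeTrack (Γ : CellExt.{u} C) : NCat.{u} (n + 1) := Γ.invRel.quotient

/-- The `(n+1)`-cell of `C(Γ)` represented by a formal composite. -/
def tk (Γ : CellExt.{u} C) {a b : C.Cell} (p : Γ.double.Term a b) : Γ.freeTrack.Cell :=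
  Γ.invRel.cls (Γ.double.fmk p)

section

variable (Γ : CellExt.{u} C) {a b c d : C.Cell} (p : Γ.double.Term a b)

theorem dom_tk : Γ.freeTrack.dom (Γ.tk p) = Γ.tk (.id a) :=
  (Γ.invRel.qsrc_cls _ _).trans (congrArg _ (Γ.double.fsrc_last p))

theorem cod_tk : Γ.freeTrack.cod (Γ.tk p) = Γ.tk (.id b) :=
  (Γ.invRel.qtgt_cls _ _).trans (congrArg _ (Γ.double.ftgt_last p))

theorem src_tk (i : Fin n) :
    Γ.freeTrack.src i.castSucc (Γ.tk p) = Γ.tk (.id (C.src i a)) :=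
  (Γ.invRel.qsrc_cls _ _).trans (congrArg _ (Γ.double.fsrc_castSucc p i))

theorem tgt_tk (i : Fin n) :
    Γ.freeTrack.tgt i.castSucc (Γ.tk p) = Γ.tk (.id (C.tgt i b)) :=
  (Γ.invRel.qtgt_cls _ _).trans (congrArg _ (Γ.double.ftgt_castSucc p i))

theorem star_tk (q : Γ.double.Term b c) (h) :
    Γ.freeTrack.star (Γ.tk p) (Γ.tk q) h = Γ.tk (.top p q) :=
  (Γ.invRel.qcomp_cls _ _ _ h).trans (congrArg _ (Γ.double.fcomp_last p q _))

theorem comp_tk (q : Γ.double.Term c d) (i : Fin n) (h₁ h₂) (h) :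
    Γ.freeTrack.comp i.castSucc (Γ.tk p) (Γ.tk q) h = Γ.tk (.low i p q h₁ h₂) :=
  (Γ.invRel.qcomp_cls _ _ _ h).trans (congrArg _ (Γ.double.fcomp_castSucc p q i _))

theorem cond_tk (q : Γ.double.Term b c) :
    Γ.freeTrack.cod (Γ.tk p) = Γ.freeTrack.dom (Γ.tk q) := by rw [cod_tk, dom_tk]

end

theorem freeTrack_isTrack (Γ : CellExt.{u} C) : Γ.freeTrack.IsTrack := by
  have key : ∀ (a b : C.Cell) (p : Γ.double.Term a b), ∃ q : Γ.double.Term b a,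
      Γ.freeTrack.IsInverse (Γ.tk p) (Γ.tk q) := by
    intro a b p
    have hgen₁ : ∀ γ, Γ.tk (.top (Γ.pos γ) (Γ.neg γ)) = Γ.tk (.id (Γ.s γ)) := fun γ =>
      cls_eq.2 (.gen (Γ := Γ.invRel) (Sum.inl γ))
    have hgen₂ : ∀ γ, Γ.tk (.top (Γ.neg γ) (Γ.pos γ)) = Γ.tk (.id (Γ.t γ)) := fun γ =>
      cls_eq.2 (.gen (Γ := Γ.invRel) (Sum.inr γ))
    induction p with
    | gen γ =>
      cases γ with
      | inl γ =>
        exact ⟨Γ.neg γ, Γ.cond_tk (Γ.pos γ) (Γ.neg γ), Γ.cond_tk (Γ.neg γ) (Γ.pos γ),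
          (Γ.star_tk (Γ.pos γ) (Γ.neg γ) _).trans ((hgen₁ γ).trans (Γ.dom_tk (Γ.pos γ)).symm),
          (Γ.star_tk (Γ.neg γ) (Γ.pos γ) _).trans ((hgen₂ γ).trans (Γ.cod_tk (Γ.pos γ)).symm)⟩
      | inr γ =>
        exact ⟨Γ.pos γ, Γ.cond_tk (Γ.neg γ) (Γ.pos γ), Γ.cond_tk (Γ.pos γ) (Γ.neg γ),
          (Γ.star_tk (Γ.neg γ) (Γ.pos γ) _).trans ((hgen₂ γ).trans (Γ.dom_tk (Γ.neg γ)).symm),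
          (Γ.star_tk (Γ.pos γ) (Γ.neg γ) _).trans ((hgen₁ γ).trans (Γ.cod_tk (Γ.neg γ)).symm)⟩
    | id a =>
      have := Γ.freeTrack.isInverse_dom (Γ.tk (.id a))
      rw [dom_tk] at this
      exact ⟨.id a, this⟩
    | top p q ihp ihq =>
      obtain ⟨p', hp⟩ := ihp
      obtain ⟨q', hq⟩ := ihq
      have := hp.star hq (Γ.cond_tk p q) (Γ.cond_tk q' p')
      rw [star_tk, star_tk] at this
      exact ⟨_, this⟩
    | low i p q h h' ihp ihq =>
      obtain ⟨p', hp⟩ := ihp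
      obtain ⟨q', hq⟩ := ihq
      have := hp.comp hq i 
        ((Γ.tgt_tk p i).trans ((congrArg (fun c => Γ.tk (.id c))
          (h'.trans (q.parallel i).1.symm)).trans (Γ.src_tk q i).symm))
        ((Γ.tgt_tk p' i).trans ((congrArg (fun c => Γ.tk (.id c))
          (h.trans (q.parallel i).1)).trans (Γ.src_tk q' i).symm))
      rw [comp_tk _ _ _ _ h h', comp_tk _ _ _ _ h' h] at this
      exact ⟨_, this⟩
  intro x
  obtain ⟨y, rfl⟩ := Γ.invRel.cls_surj x
  obtain ⟨a, b, p, rfl⟩ := Γ.double.fmk_surj y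
  obtain ⟨q, hq⟩ := key a b p
  exact ⟨_, hq⟩

end CellExt

/-! ### Polygraphs -/

/-- The type of `n`-polygraphs together with the free `n`-categories they generate, by induction on
`n`: a `0`-polygraph is a set, and an `(n+1)`-polygraph is an `n`-polygraph with a cellular
extension of the free `n`-category it generates (so that a `1`-polygraph is a graph). -/
def polygraphAux : (n : ℕ) → (P : Type (u + 1)) × (P → NCat.{u} n)
  | 0 => ⟨Type u, NCat.discrete⟩
  | n + 1 => ⟨(p : (polygraphAux n).1) × CellExt.{u} ((polygraphAux n).2 p), fun S => S.2.free⟩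

/-- `n`-polygraphs. -/
def Polygraph (n : ℕ) : Type (u + 1) := (polygraphAux.{u} n).1

namespace Polygraph

/-- The free `n`-category `Σ^*` generated by an `n`-polygraph. -/
def freeCat {n : ℕ} (S : Polygraph.{u} n) : NCat.{u} n := (polygraphAux.{u} n).2 S

/-- The underlying `n`-polygraph of an `(n+1)`-polygraph. -/
def base {n : ℕ} (S : Polygraph.{u} (n + 1)) : Polygraph.{u} n := Sigma.fst S

/-- The `(n+1)`-cells of an `(n+1)`-polygraph. -/
def ext {n : ℕ} (S : Polygraph.{u} (n + 1)) : CellExt.{u} S.base.freeCat := Sigma.snd S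

/-- A polygraph is finite when its sets of `k`-cells are finite for all `k ≤ n`. -/
def IsFinite : {n : ℕ} → Polygraph.{u} n → Prop
  | 0, S => Finite (show Type u from S)
  | _ + 1, S => IsFinite (base S) ∧ Finite (ext S).Gen

/-- The free track `(n+1)`-category `Σ^⊤` generated by an `(n+1)`-polygraph. -/
def freeTrack {n : ℕ} (S : Polygraph.{u} (n + 1)) : NCat.{u} (n + 1) := S.ext.freeTrack

theorem freeTrack_isTrack {n : ℕ} (S : Polygraph.{u} (n + 1)) : S.freeTrack.IsTrack :=
  S.ext.freeTrack_isTrack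

/-- Finite derivation type: the polygraph is finite and its free track category has a finite
homotopy basis. -/
def FiniteDerivationType {n : ℕ} (S : Polygraph.{u} (n + 1)) : Prop :=
  S.IsFinite ∧ ∃ B : CellExt.{u} S.freeTrack, Finite B.Gen ∧ B.IsHomotopyBasis

end Polygraph

/-! ### Closed cells, abelianization, presented category -/

namespace NCat

variable {n : ℕ}

/-- An `(n+1)`-cell is closed when its source and target `n`-cells are equal. -/
def IsClosed (T : NCat.{u} (n + 1)) (f : T.Cell) : Prop := T.dom f = T.cod f

theorem IsClosed.star_cond {T : NCat.{u} (n + 1)} {f g : T.Cell} (hf : T.IsClosed f)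
    (h : T.dom f = T.dom g) : T.cod f = T.dom g := hf.symm.trans h

theorem IsClosed.star {T : NCat.{u} (n + 1)} {f g : T.Cell} (hf : T.IsClosed f)
    (hg : T.IsClosed g) (h : T.dom f = T.dom g) : T.IsClosed (T.star f g (hf.star_cond h)) := by
  unfold IsClosed
  rw [dom_star, cod_star, ← hg, h]

/-- The spheres `(f ⋆_n g, g ⋆_n f)`, for closed `(n+1)`-cells `f`, `g` with the same base. -/
def commRel (T : NCat.{u} (n + 1)) : CellExt.{u} T where
  Gen := {p : T.Cell × T.Cell // T.IsClosed p.1 ∧ T.IsClosed p.2 ∧ T.dom p.1 = T.dom p.2}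
  s p := T.star p.1.1 p.1.2 (p.2.1.star_cond p.2.2.2)
  t p := T.star p.1.2 p.1.1 (p.2.2.1.star_cond p.2.2.2.symm)
  parallel p := by
    obtain ⟨⟨f, g⟩, hf, hg, h⟩ := p
    have hc : T.cod f = T.cod g := hf.symm.trans (h.trans hg)
    intro i
    induction i using Fin.lastCases with
    | last => exact ⟨(T.dom_star _ _ _).trans (h.trans (T.dom_star _ _ _).symm),
        (T.cod_star _ _ _).trans (hc.symm.trans (T.cod_star _ _ _).symm)⟩
    | cast i =>
      rw [src_star, src_star, tgt_star, tgt_star, ← T.src_dom i f, ← T.src_dom i g,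
        ← T.tgt_dom i f, ← T.tgt_dom i g]
      change T.dom f = T.dom g at h
      rw [h]
      exact ⟨rfl, rfl⟩

/-- The abelianized track category. -/
def abelianization (T : NCat.{u} (n + 1)) : NCat.{u} (n + 1) := T.commRel.quotient

theorem abelianization_isTrack {T : NCat.{u} (n + 1)} (hT : T.IsTrack) :
    T.abelianization.IsTrack := T.commRel.quotient_isTrack hT

/-- The source of an `(n+1)`-cell, as an `n`-cell of the underlying `n`-category. -/
def bdom (T : NCat.{u} (n + 1)) (f : T.Cell) : T.trunc.Cell := ⟨T.dom f, T.dom_dom f⟩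

/-- The target of an `(n+1)`-cell, as an `n`-cell of the underlying `n`-category. -/
def bcod (T : NCat.{u} (n + 1)) (f : T.Cell) : T.trunc.Cell := ⟨T.cod f, T.dom_cod f⟩

/-- The `(n+1)`-cells of `T`, as a cellular extension of the underlying `n`-category of `T`. -/
def cells (T : NCat.{u} (n + 1)) : CellExt.{u} T.trunc where
  Gen := T.Cell
  s := T.bdom
  t := T.bcod
  parallel f i := ⟨Subtype.ext ((T.src_dom i f).trans (T.src_cod i f).symm),
    Subtype.ext ((T.tgt_dom i f).trans (T.tgt_cod i f).symm)⟩

/-- The `n`-category presented by a track `(n+1)`-category `T`. -/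
def presented (T : NCat.{u} (n + 1)) : NCat.{u} n := T.cells.quotient

/-- The class in the presented `n`-category of the source of an `(n+1)`-cell `f`; when `f` is
closed this is the class of its base. -/
def baseClass (T : NCat.{u} (n + 1)) (f : T.Cell) : T.presented.Cell := T.cells.cls (T.bdom f)

theorem baseClass_eq_cod (T : NCat.{u} (n + 1)) (f : T.Cell) :
    T.baseClass f = T.cells.cls (T.bcod f) := CellExt.cls_eq.2 (.gen (Γ := T.cells) f)

theorem baseClass_congr (T : NCat.{u} (n + 1)) {f g : T.Cell} (h : T.dom f = T.dom g) :
    T.baseClass f = T.baseClass g := congrArg T.cells.cls (Subtype.ext h)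

theorem baseClass_star_comm (T : NCat.{u} (n + 1)) (f g : T.Cell) (h : T.cod f = T.dom g)
    (h' : T.cod g = T.dom f) : T.baseClass (T.star f g h) = T.baseClass (T.star g f h') := by
  rw [T.baseClass_congr (T.dom_star f g h), T.baseClass_congr (T.dom_star g f h'),
    T.baseClass_eq_cod f]
  exact congrArg T.cells.cls (Subtype.ext h)

end NCat

/-! ### Contexts and natural systems -/

/-- Formal composites of `n`-cells of `C` and of an indeterminate `n`-cell `x` (the constructor
`hole`) parallel to the `n`-cell `u`.  `CTerm C u v` is the set of those that become `v` when `x` is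
replaced by `u`; note that the sources and targets of a composite only depend on the boundary of
`x`, so that they can be read off from `v`. -/
inductive CTerm {n : ℕ} (C : NCat.{u} n) (u : C.Cell) : C.Cell → Type u
  | hole : CTerm C u u
  | of (c : C.Cell) : CTerm C u c
  | comp (i : Fin n) {a b : C.Cell} (p : CTerm C u a) (q : CTerm C u b)
      (h : C.tgt i a = C.src i b) : CTerm C u (C.comp i a b h)

namespace CTerm

variable {n : ℕ} {C D : NCat.{u} n}

/-- The number of occurrences of the indeterminate. -/
def count {u : C.Cell} : {v : C.Cell} → CTerm C u v → ℕ
  | _, .hole => 1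
  | _, .of _ => 0
  | _, .comp _ p q _ => count p + count q

theorem count_hole (u : C.Cell) : (hole : CTerm C u u).count = 1 := rfl

/-- The congruence generated by the compositions of `C` and the axioms of `n`-categories; the
classes are the `n`-cells of the `n`-category `C[x]`. -/
inductive Rel {u : C.Cell} : ∀ {a b : C.Cell}, CTerm C u a → CTerm C u b → Prop
  | refl {a} (p : CTerm C u a) : Rel p p
  | symm {a b} {p : CTerm C u a} {q : CTerm C u b} : Rel p q → Rel q p
  | trans {a b c} {p : CTerm C u a} {q : CTerm C u b} {r : CTerm C u c} :
      Rel p q → Rel q r → Rel p r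
  | comp_congr (i : Fin n) {a b a' b'} {p : CTerm C u a} {q : CTerm C u b} {p' : CTerm C u a'}
      {q' : CTerm C u b'} (h h') : Rel p p' → Rel q q' → Rel (comp i p q h) (comp i p' q' h')
  | of_comp (i : Fin n) (a b : C.Cell) (h) :
      Rel (comp i (of a) (of b) h) (of (C.comp i a b h))
  | assoc (i : Fin n) {a b c} (p : CTerm C u a) (q : CTerm C u b) (r : CTerm C u c) (h₁ h₂ h₃ h₄) :
      Rel (comp i (comp i p q h₁) r h₂) (comp i p (comp i q r h₃) h₄)
  | id_comp (i : Fin n) {a} (p : CTerm C u a) (h) : Rel (comp i (of (C.src i a)) p h) p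
  | comp_id (i : Fin n) {a} (p : CTerm C u a) (h) : Rel (comp i p (of (C.tgt i a)) h) p
  | exchange {i j : Fin n} (hij : i < j) {a b c d} (p : CTerm C u a) (q : CTerm C u b)
      (r : CTerm C u c) (s : CTerm C u d) (h₁ h₂ h₃ h₄ h₅ h₆) :
      Rel (comp i (comp j p q h₁) (comp j r s h₂) h₃) (comp j (comp i p r h₄) (comp i q s h₅) h₆)

theorem Rel.count_eq {u a b : C.Cell} {p : CTerm C u a} {q : CTerm C u b} (h : Rel p q) :
    p.count = q.count := by
  induction h with
  | refl => rfl
  | symm _ ih => exact ih.symm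
  | trans _ _ ih₁ ih₂ => exact ih₁.trans ih₂
  | comp_congr i h h' _ _ ih₁ ih₂ => simp only [count, ih₁, ih₂]
  | of_comp => rfl
  | assoc => simp only [count, add_assoc]
  | id_comp => simp only [count, zero_add]
  | comp_id => simp only [count, add_zero]
  | exchange => simp only [count]; omega

/-- Substitution of a formal composite for the indeterminate. -/
def subst {u v : C.Cell} (p : CTerm C u v) : {w : C.Cell} → CTerm C v w → CTerm C u w
  | _, .hole => p
  | _, .of c => .of c
  | _, .comp i q r h => .comp i (subst p q) (subst p r) h

theorem count_subst {u v w : C.Cell} (p : CTerm C u v) (q : CTerm C v w) :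
    (p.subst q).count = p.count * q.count := by
  induction q with
  | hole => simp [subst, count]
  | of c => simp [subst, count]
  | comp i q r h ih₁ ih₂ => simp [subst, count, ih₁, ih₂, mul_add]

theorem subst_hole {u v : C.Cell} (p : CTerm C u v) : CTerm.hole.subst p = p := by
  induction p with
  | hole => rfl
  | of c => rfl
  | comp i q r h ih₁ ih₂ => simp only [subst, ih₁, ih₂]

theorem subst_subst {u v w x : C.Cell} (p : CTerm C u v) (q : CTerm C v w) (r : CTerm C w x) :
    p.subst (q.subst r) = (p.subst q).subst r := by
  induction r with
  | hole => rfl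
  | of c => rfl
  | comp i r s h ih₁ ih₂ => simp only [subst, ih₁, ih₂]

theorem Rel.subst_right {u v w w' : C.Cell} (p : CTerm C u v) {q : CTerm C v w}
    {q' : CTerm C v w'} (h : Rel q q') : Rel (p.subst q) (p.subst q') := by
  induction h with
  | refl => exact .refl _
  | symm _ ih => exact ih.symm
  | trans _ _ ih₁ ih₂ => exact ih₁.trans ih₂
  | comp_congr i h h' _ _ ih₁ ih₂ => exact .comp_congr i h h' ih₁ ih₂
  | of_comp i a b h => exact .of_comp i a b h
  | assoc i p q r h₁ h₂ h₃ h₄ => exact .assoc i _ _ _ h₁ h₂ h₃ h₄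
  | id_comp i p h => exact .id_comp i _ h
  | comp_id i p h => exact .comp_id i _ h
  | exchange hij p q r s h₁ h₂ h₃ h₄ h₅ h₆ => exact .exchange hij _ _ _ _ h₁ h₂ h₃ h₄ h₅ h₆

theorem Rel.subst_left {u v w : C.Cell} {p p' : CTerm C u v} (h : Rel p p') (q : CTerm C v w) :
    Rel (p.subst q) (p'.subst q) := by
  induction q with
  | hole => exact h
  | of c => exact .refl _
  | comp i q r h' ih₁ ih₂ => exact .comp_congr i h' h' ih₁ ih₂

/-- The value of a formal composite under an `n`-functor `F`, when the indeterminate is replaced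
by an `n`-cell `d` parallel to `F u`. -/
def eval (F : NFunctor C D) {u : C.Cell} (d : D.Cell) (hd : D.Parallel (F.map u) d) :
    {v : C.Cell} → CTerm C u v → {e : D.Cell // D.Parallel (F.map v) e}
  | _, .hole => ⟨d, hd⟩
  | _, .of c => ⟨F.map c, .refl _ _⟩
  | _, .comp i p q h =>
    ⟨D.comp i (eval F d hd p).1 (eval F d hd q).1
      (NCat.comp_cond (eval F d hd p).2 (eval F d hd q).2 (F.cond h)), by
      rw [F.map_comp i _ _ h (F.cond h)]
      exact (eval F d hd p).2.comp (eval F d hd q).2 i _ _⟩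

theorem Rel.eval_eq (F : NFunctor C D) {u : C.Cell} (d : D.Cell) (hd : D.Parallel (F.map u) d)
    {v w : C.Cell} {p : CTerm C u v} {q : CTerm C u w} (h : Rel p q) :
    (p.eval F d hd).1 = (q.eval F d hd).1 := by
  induction h with
  | refl => rfl
  | symm _ ih => exact ih.symm
  | trans _ _ ih₁ ih₂ => exact ih₁.trans ih₂
  | comp_congr i h h' _ _ ih₁ ih₂ => exact D.comp_congr ih₁ ih₂
  | of_comp i a b h => exact (F.map_comp i a b h (F.cond h)).symm
  | assoc i p q r h₁ h₂ h₃ h₄ => exact D.assoc _ _ _ _ _ _ _ _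
  | id_comp i p h =>
    exact (D.comp_congr ((F.map_src i _).trans ((p.eval F d hd).2 i).1) rfl).trans
      (D.id_comp i _ (D.tgt_src_of_le le_rfl _))
  | comp_id i p h =>
    exact (D.comp_congr rfl ((F.map_tgt i _).trans ((p.eval F d hd).2 i).2)).trans
      (D.comp_id i _ (D.src_tgt_of_le le_rfl _).symm)
  | exchange hij p q r s h₁ h₂ h₃ h₄ h₅ h₆ => exact D.exchange hij _ _ _ _ _ _ _ _ _ _

theorem eval_congr (F : NFunctor C D) {u : C.Cell} {d d' : D.Cell} (hd : D.Parallel (F.map u) d)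
    (hd' : D.Parallel (F.map u) d') (e : d = d') {v : C.Cell} (p : CTerm C u v) :
    (p.eval F d hd).1 = (p.eval F d' hd').1 := by
  subst e; rfl

theorem eval_subst (F : NFunctor C D) {u v w : C.Cell} (d : D.Cell)
    (hd : D.Parallel (F.map u) d) (p : CTerm C u v) (q : CTerm C v w) :
    ((p.subst q).eval F d hd).1 = (q.eval F (p.eval F d hd).1 (p.eval F d hd).2).1 := by
  induction q with
  | hole => rfl
  | of c => rfl
  | comp i q r h ih₁ ih₂ => exact D.comp_congr ih₁ ih₂

theorem eval_of_count_eq_zero (F : NFunctor C D) {u v : C.Cell} (d : D.Cell)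
    (hd : D.Parallel (F.map u) d) (p : CTerm C u v) (hp : p.count = 0) :
    (p.eval F d hd).1 = F.map v := by
  induction p with
  | hole => exact absurd hp one_ne_zero
  | of c => rfl
  | comp i q r h ih₁ ih₂ =>
    simp only [count] at hp
    exact (D.comp_congr (ih₁ (by omega)) (ih₂ (by omega))).trans
      (F.map_comp i _ _ h (F.cond h)).symm

theorem map_eval {F : NFunctor C D} {G : NFunctor D C} (hG : ∀ x, G.map (F.map x) = x)
    {u v : C.Cell} (d : D.Cell) (hd : D.Parallel (F.map u) d) (hGd : G.map d = u)
    (p : CTerm C u v) : G.map (p.eval F d hd).1 = v := by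
  induction p with
  | hole => exact hGd
  | of c => exact hG c
  | comp i q r h ih₁ ih₂ =>
    refine (G.map_comp i _ _ _ (G.cond ?_)).trans (C.comp_congr ih₁ ih₂)
    exact NCat.comp_cond (q.eval F d hd).2 (r.eval F d hd).2 (F.cond h)

end CTerm

/-- The category `Ct(C)` of contexts of an `n`-category `C`: its objects are the `n`-cells. -/
structure Ctx {n : ℕ} (C : NCat.{u} n) : Type u where
  cell : C.Cell

namespace Ctx

variable {n : ℕ} {C : NCat.{u} n}

def setoid (u v : C.Cell) : Setoid (CTerm C u v) :=
  ⟨CTerm.Rel, ⟨.refl, .symm, .trans⟩⟩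

/-- The `n`-cells of `C[x]`, with `x` parallel to `u`, that become `v` when `x` is replaced by
`u`. -/
def IndetCell (u v : C.Cell) : Type u := Quotient (setoid u v)

def icount {u v : C.Cell} (p : IndetCell u v) : ℕ :=
  Quotient.lift (s := setoid u v) CTerm.count (fun _ _ h => CTerm.Rel.count_eq h) p

/-- A context from `u` to `v`: an `n`-cell of `C[x]`, with `x` parallel to `u`, in which `x` occurs
exactly once, and that becomes `v` when `x` is replaced by `u`. -/
def Hom (u v : C.Cell) : Type u := {p : IndetCell u v // icount p = 1}

def mkHom {u v : C.Cell} (p : CTerm C u v) (hp : p.count = 1) : Hom u v :=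
  ⟨Quotient.mk (setoid u v) p, hp⟩

theorem mkHom_surj {u v : C.Cell} (φ : Hom u v) : ∃ p hp, mkHom (u := u) (v := v) p hp = φ := by
  obtain ⟨p, hp⟩ := φ
  obtain ⟨q, rfl⟩ := Quotient.exists_rep p
  exact ⟨q, hp, rfl⟩

def rep {u v : C.Cell} (φ : Hom u v) : CTerm C u v := (mkHom_surj φ).choose

theorem rep_count {u v : C.Cell} (φ : Hom u v) : (rep φ).count = 1 := (mkHom_surj φ).choose_spec.choose

theorem mkHom_rep {u v : C.Cell} (φ : Hom u v) : mkHom (rep φ) (rep_count φ) = φ :=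
  (mkHom_surj φ).choose_spec.choose_spec

theorem mkHom_eq {u v : C.Cell} {p q : CTerm C u v} {hp hq} (h : CTerm.Rel p q) :
    mkHom p hp = mkHom q hq := Subtype.ext (Quotient.sound (s := setoid u v) h)

theorem rel_of_mkHom_eq {u v : C.Cell} {p q : CTerm C u v} {hp hq}
    (h : mkHom p hp = mkHom q hq) : CTerm.Rel p q :=
  Quotient.exact (s := setoid u v) (congrArg Subtype.val h)

theorem rep_mkHom {u v : C.Cell} (p : CTerm C u v) (hp) : CTerm.Rel (rep (mkHom p hp)) p :=
  rel_of_mkHom_eq (mkHom_rep (mkHom p hp))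

/-- Composition of contexts: `(ψ ∘ φ)[x] = ψ[φ[x]]`. -/
def compHom {u v w : C.Cell} (φ : Hom u v) (ψ : Hom v w) : Hom u w :=
  mkHom ((rep φ).subst (rep ψ)) (by rw [CTerm.count_subst, rep_count, rep_count])

theorem compHom_mk {u v w : C.Cell} (p : CTerm C u v) (q : CTerm C v w) (hp hq) :
    compHom (mkHom p hp) (mkHom q hq) =
      mkHom (p.subst q) (by rw [CTerm.count_subst, hp, hq]) :=
  mkHom_eq (((rep_mkHom p hp).subst_left _).trans (CTerm.Rel.subst_right p (rep_mkHom q hq)))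

instance : CategoryTheory.Category.{u} (Ctx C) where
  Hom x y := Hom x.cell y.cell
  id x := mkHom .hole (CTerm.count_hole _)
  comp φ ψ := compHom φ ψ
  id_comp φ := by
    obtain ⟨p, hp, rfl⟩ := mkHom_surj φ
    exact (compHom_mk .hole p (CTerm.count_hole _) hp).trans (mkHom_eq (by rw [CTerm.subst_hole]; exact .refl _))
  comp_id φ := by
    obtain ⟨p, hp, rfl⟩ := mkHom_surj φ
    exact (compHom_mk p .hole hp (CTerm.count_hole _)).trans (mkHom_eq (.refl _))
  assoc φ ψ χ := by
    obtain ⟨p, hp, rfl⟩ := mkHom_surj φ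
    obtain ⟨q, hq, rfl⟩ := mkHom_surj ψ
    obtain ⟨r, hr, rfl⟩ := mkHom_surj χ
    refine (congrArg (compHom · _) (compHom_mk p q hp hq)).trans ?_
    refine Eq.trans ?_ (congrArg (compHom _ ·) (compHom_mk q r hq hr)).symm
    refine (compHom_mk _ _ _ _).trans (Eq.trans ?_ (compHom_mk _ _ _ _).symm)
    exact mkHom_eq (by rw [CTerm.subst_subst]; exact .refl _)

end Ctx

/-- Abelian natural systems on an `n`-category `C`: functors from the category of contexts of `C`
to abelian groups. -/
abbrev AbNaturalSystem {n : ℕ} (C : NCat.{u} n) : Type (u + 1) :=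
  CategoryTheory.Functor (Ctx C) AddCommGrpCat.{u}

namespace AbNaturalSystem

variable {n : ℕ} {C : NCat.{u} n}

/-- A family `X` of elements of a natural system `D` generates it when each group `D_v` is
generated by the elements `φ[x]`, for `x ∈ D_u` in the family and `φ` a context from `u` to `v`. -/
def Generates (D : AbNaturalSystem C) (X : Set ((u : Ctx C) × D.obj u)) : Prop :=
  ∀ v : Ctx C, AddSubgroup.closure
    {y : D.obj v | ∃ x ∈ X, ∃ φ : x.1 ⟶ v, y = D.map φ x.2} = ⊤

def FinitelyGenerated (D : AbNaturalSystem C) : Prop :=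
  ∃ X : Set ((u : Ctx C) × D.obj u), X.Finite ∧ D.Generates X

end AbNaturalSystem

/-! ### The natural system of identities among relations -/

/-- Closed `(n+1)`-cells `f : a → a` of `T` whose base `a` has class `v` in the presented
`n`-category. -/
structure ClosedOver {n : ℕ} (T : NCat.{u} (n + 1)) (v : T.presented.Cell) : Type u where
  cell : T.Cell
  closed : T.IsClosed cell
  base : T.baseClass cell = v

namespace NCat

variable {n : ℕ}

/-- The defining relations of `Π(T)_v`:
(i) `⌊f ⋆_n g⌋ = ⌊f⌋ + ⌊g⌋` for `f : a → a` and `g : a → a` with `a` of class `v`;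
(ii) `⌊f ⋆_n g⌋ = ⌊g ⋆_n f⌋` for `f : a → b` and `g : b → a` with `a` and `b` of class `v`. -/
inductive PiRel (T : NCat.{u} (n + 1)) (v : T.presented.Cell) :
    FreeAbelianGroup (ClosedOver T v) → Prop
  | add (f g k : ClosedOver T v) (h : T.cod f.cell = T.dom g.cell)
      (hk : k.cell = T.star f.cell g.cell h) :
      PiRel T v (FreeAbelianGroup.of k - (FreeAbelianGroup.of f + FreeAbelianGroup.of g))
  | cyc (f g : T.Cell) (h : T.cod f = T.dom g) (h' : T.cod g = T.dom f) (k l : ClosedOver T v)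
      (hk : k.cell = T.star f g h) (hl : l.cell = T.star g f h') :
      PiRel T v (FreeAbelianGroup.of k - FreeAbelianGroup.of l)

/-- The abelian group `Π(T)_v`, by generators and relations. -/
def PiGroup (T : NCat.{u} (n + 1)) (v : T.presented.Cell) : Type u :=
  FreeAbelianGroup (ClosedOver T v) ⧸ AddSubgroup.closure {x | T.PiRel v x}

instance (T : NCat.{u} (n + 1)) (v : T.presented.Cell) : AddCommGroup (T.PiGroup v) :=
  inferInstanceAs (AddCommGroup (FreeAbelianGroup (ClosedOver T v) ⧸ _))

/-- The element `⌊f⌋` of `Π(T)_v`. -/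
def iar (T : NCat.{u} (n + 1)) {v : T.presented.Cell} (f : ClosedOver T v) : T.PiGroup v :=
  QuotientAddGroup.mk (FreeAbelianGroup.of f)

theorem iar_add (T : NCat.{u} (n + 1)) {v : T.presented.Cell} (f g k : ClosedOver T v)
    (h : T.cod f.cell = T.dom g.cell) (hk : k.cell = T.star f.cell g.cell h) :
    T.iar k = T.iar f + T.iar g := by
  have := (QuotientAddGroup.eq_zero_iff (N := AddSubgroup.closure {x | T.PiRel v x}) _).2
    (AddSubgroup.subset_closure (PiRel.add f g k h hk))
  exact sub_eq_zero.1 this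

theorem iar_cyc (T : NCat.{u} (n + 1)) {v : T.presented.Cell} (f g : T.Cell)
    (h : T.cod f = T.dom g) (h' : T.cod g = T.dom f) (k l : ClosedOver T v)
    (hk : k.cell = T.star f g h) (hl : l.cell = T.star g f h') : T.iar k = T.iar l := by
  have := (QuotientAddGroup.eq_zero_iff (N := AddSubgroup.closure {x | T.PiRel v x}) _).2
    (AddSubgroup.subset_closure (PiRel.cyc f g h h' k l hk hl))
  exact sub_eq_zero.1 this

/-- Homomorphisms out of `Π(T)_v` are given by maps on generators compatible with the relations. -/
def piLift (T : NCat.{u} (n + 1)) {v : T.presented.Cell} {A : Type u} [AddCommGroup A]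
    (m : ClosedOver T v → A)
    (h₁ : ∀ (f g k : ClosedOver T v) (h : T.cod f.cell = T.dom g.cell),
      k.cell = T.star f.cell g.cell h → m k = m f + m g)
    (h₂ : ∀ (f g : T.Cell) (h : T.cod f = T.dom g) (h' : T.cod g = T.dom f)
      (k l : ClosedOver T v), k.cell = T.star f g h → l.cell = T.star g f h' → m k = m l) :
    T.PiGroup v →+ A :=
  QuotientAddGroup.lift _ (FreeAbelianGroup.lift m) (by
    rw [AddSubgroup.closure_le]
    rintro x (⟨f, g, k, h, hk⟩ | ⟨f, g, h, h', k, l, hk, hl⟩)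
    · simp [h₁ f g k h hk]
    · simp [h₂ f g h h' k l hk hl])

theorem piLift_iar (T : NCat.{u} (n + 1)) {v : T.presented.Cell} {A : Type u} [AddCommGroup A]
    (m : ClosedOver T v → A) (h₁ h₂) (f : ClosedOver T v) : T.piLift m h₁ h₂ (T.iar f) = m f :=
  FreeAbelianGroup.lift_apply_of m f

theorem pi_hom_ext (T : NCat.{u} (n + 1)) {v : T.presented.Cell} {A : Type u} [AddCommGroup A]
    {φ ψ : T.PiGroup v →+ A} (h : ∀ f, φ (T.iar f) = ψ (T.iar f)) : φ = ψ := by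
  exact QuotientAddGroup.addMonoidHom_ext _ (FreeAbelianGroup.lift_ext _ _ h)

/-! To let a context `C` of the presented `n`-category act on `⌊f⌋`, one lifts `C` to a context `B`
of `n`-cells of `T` and takes `⌊B[f]⌋`.  The value does not depend on the lift because, up to
the relation `f ⋆_n g ∼ g ⋆_n f`, closed `(n+1)`-cells with the compositions `⋆_i`, `i < n`,
form an `n`-category in which the `n`-cells of the presented `n`-category can be interpreted as
(classes of) identities.  So `C[f]` is computed in that `n`-category. -/

/-- The closed `(n+1)`-cells of `T`, with the compositions `⋆_i` for `i < n`. -/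
def closedCells (T : NCat.{u} (n + 1)) : NCat.{u} n :=
  T.forget.sub T.IsClosed
    (fun i x _ => (T.src_src_of_le (Fin.le_last i.castSucc) x).trans
      (T.tgt_src_of_le (Fin.le_last i.castSucc) x).symm)
    (fun i x _ => (T.src_tgt_of_le (Fin.le_last i.castSucc) x).trans
      (T.tgt_tgt_of_le (Fin.le_last i.castSucc) x).symm)
    (fun i x y h hx hy => (T.dom_comp i x y h).trans
      ((T.comp_congr hx hy).trans (T.cod_comp i x y h).symm))

theorem isClosed_star_comm (T : NCat.{u} (n + 1)) {f g : T.Cell} (h : T.cod f = T.dom g)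
    (h' : T.cod g = T.dom f) : T.IsClosed (T.star f g h) := by
  unfold IsClosed
  rw [dom_star, cod_star, h']

/-- The relation `f ⋆_n g ∼ g ⋆_n f`, for `f : a → b` and `g : b → a`. -/
def cycRel (T : NCat.{u} (n + 1)) : CellExt.{u} T.closedCells where
  Gen := {p : T.Cell × T.Cell // T.cod p.1 = T.dom p.2 ∧ T.cod p.2 = T.dom p.1}
  s p := ⟨T.star p.1.1 p.1.2 p.2.1, T.isClosed_star_comm p.2.1 p.2.2⟩
  t p := ⟨T.star p.1.2 p.1.1 p.2.2, T.isClosed_star_comm p.2.2 p.2.1⟩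
  parallel p i := by
    obtain ⟨⟨f, g⟩, h, h'⟩ := p
    change T.cod f = T.dom g at h
    change T.cod g = T.dom f at h'
    constructor
    · refine Subtype.ext ((T.src_star i f g h).trans (Eq.trans ?_ (T.src_star i g f h').symm))
      rw [← T.src_dom i g, ← h, T.src_cod]
    · refine Subtype.ext ((T.tgt_star i f g h).trans (Eq.trans ?_ (T.tgt_star i g f h').symm))
      rw [← T.tgt_dom i f, ← h', T.tgt_cod]

/-- Closed `(n+1)`-cells up to the relation `f ⋆_n g ∼ g ⋆_n f`. -/
abbrev loops (T : NCat.{u} (n + 1)) : NCat.{u} n := T.cycRel.quotient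

/-- The class of a closed `(n+1)`-cell. -/
def toLoop (T : NCat.{u} (n + 1)) (f : T.Cell) (hf : T.IsClosed f) : T.loops.Cell :=
  T.cycRel.cls ⟨f, hf⟩

/-- The base of a closed cell. -/
def baseFunctor (T : NCat.{u} (n + 1)) : NFunctor T.closedCells T.trunc where
  map f := T.bdom f.1
  map_src i f := Subtype.ext ((T.src_src_of_le (Fin.le_last i.castSucc) f.1).trans
    (T.src_dom i f.1).symm)
  map_tgt i f := Subtype.ext ((T.src_tgt_of_le (Fin.le_last i.castSucc) f.1).trans
    (T.tgt_dom i f.1).symm)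
  map_comp i f g h _ := Subtype.ext (T.dom_comp i f.1 g.1 (congrArg Subtype.val h))

/-- The base of a loop, in the presented `n`-category. -/
def loopBase (T : NCat.{u} (n + 1)) : NFunctor T.loops T.presented :=
  T.baseFunctor.onQuotient T.cycRel T.cells (fun p =>
    CellExt.cls_eq.1 (T.baseClass_star_comm p.1.1 p.1.2 p.2.1 p.2.2))

theorem loopBase_toLoop (T : NCat.{u} (n + 1)) (f : T.Cell) (hf) :
    T.loopBase.map (T.toLoop f hf) = T.baseClass f :=
  T.baseFunctor.qmap_cls (Γ := T.cycRel) (fun p =>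
    CellExt.cls_eq.1 (T.baseClass_star_comm p.1.1 p.1.2 p.2.1 p.2.2)) _

/-- An `n`-cell, as a closed `(n+1)`-cell (an identity). -/
def idFunctor (T : NCat.{u} (n + 1)) : NFunctor T.trunc T.closedCells where
  map a := ⟨a.1, a.2.trans (by
    have h : T.dom a.1 = a.1 := a.2
    have := T.cod_dom a.1
    rw [h] at this
    exact this.symm)⟩
  map_src _ _ := rfl
  map_tgt _ _ := rfl
  map_comp _ _ _ _ _ := rfl

theorem idFunctor_cong (T : NCat.{u} (n + 1)) (hT : T.IsTrack) (f : T.Cell) :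
    T.cycRel.Cong (T.idFunctor.map (T.bdom f)) (T.idFunctor.map (T.bcod f)) := by
  have h := (T.dom_inv hT f).symm
  have h' := T.cod_inv hT f
  have := CellExt.Cong.gen (Γ := T.cycRel) ⟨(f, T.inv hT f), h, h'⟩
  have e₁ : T.cycRel.s ⟨(f, T.inv hT f), h, h'⟩ = T.idFunctor.map (T.bdom f) :=
    Subtype.ext (T.star_inv hT f h)
  have e₂ : T.cycRel.t ⟨(f, T.inv hT f), h, h'⟩ = T.idFunctor.map (T.bcod f) :=
    Subtype.ext (T.inv_star hT f h')
  rwa [e₁, e₂] at this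

/-- An `n`-cell of the presented `n`-category, as (the class of) an identity. -/
def idLoop (T : NCat.{u} (n + 1)) (hT : T.IsTrack) : NFunctor T.presented T.loops :=
  T.idFunctor.onQuotient T.cells T.cycRel (T.idFunctor_cong hT)

theorem idLoop_cls (T : NCat.{u} (n + 1)) (hT : T.IsTrack) (a : T.trunc.Cell) :
    (T.idLoop hT).map (T.cells.cls a) = T.cycRel.cls (T.idFunctor.map a) :=
  T.idFunctor.qmap_cls (T.idFunctor_cong hT) a

theorem loopBase_idLoop (T : NCat.{u} (n + 1)) (hT : T.IsTrack) (v : T.presented.Cell) :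
    T.loopBase.map ((T.idLoop hT).map v) = v := by
  obtain ⟨a, rfl⟩ := T.cells.cls_surj v
  rw [T.idLoop_cls hT]
  refine (T.loopBase_toLoop a.1 _).trans (congrArg T.cells.cls (Subtype.ext a.2))

/-- `f ⋆_n k = k ⋆_n g` for some `k`: in a track category, `f` and `g` are conjugate. -/
def Conj (T : NCat.{u} (n + 1)) (f g : T.Cell) : Prop :=
  ∃ (k : T.Cell) (h : T.cod f = T.dom k) (h' : T.cod k = T.dom g), T.star f k h = T.star k g h'

theorem Conj.refl (T : NCat.{u} (n + 1)) {f : T.Cell} (hf : T.IsClosed f) : T.Conj f f := by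
  refine ⟨T.dom f, ?_, T.cod_dom _, ?_⟩
  · rw [dom_dom]; exact hf.symm
  · refine Eq.trans ?_ (T.dom_star_id f (T.cod_dom _)).symm
    refine (T.comp_congr rfl hf).trans (T.star_cod_id f ?_)
    exact (T.dom_cod _).symm

theorem Conj.symm {T : NCat.{u} (n + 1)} (hT : T.IsTrack) {f g : T.Cell} (hf : T.IsClosed f)
    (hg : T.IsClosed g) (hfg : T.Conj f g) : T.Conj g f := by
  obtain ⟨k, h, h', e⟩ := hfg
  have hi := T.dom_inv hT k
  have hi' := T.cod_inv hT k
  unfold IsClosed at hf hg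
  have c₁ : T.cod g = T.dom (T.inv hT k) := by rw [hi, h', hg]
  have c₂ : T.cod (T.inv hT k) = T.dom f := by rw [hi', ← h, hf]
  have c₃ : T.cod (T.inv hT k) = T.dom (T.star k g h') := by rw [dom_star, hi']
  have c₄ : T.cod (T.inv hT k) = T.dom (T.star f k h) := by rw [dom_star, c₂]
  have c₅ : T.cod (T.star (T.inv hT k) k hi') = T.dom g := by rw [cod_star, h']
  have c₆ : T.cod (T.star (T.inv hT k) f c₂) = T.dom k := by rw [cod_star, h]
  have c₇ : T.cod k = T.dom (T.inv hT k) := hi.symm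
  refine ⟨T.inv hT k, c₁, c₂, ?_⟩
  have e₁ : g = T.star (T.star (T.inv hT k) f c₂) k c₆ := by
    refine Eq.trans ?_ (T.assoc _ _ _ _ _ _ h c₄).symm
    refine Eq.trans ?_ (T.comp_congr (h := c₃) rfl e.symm)
    refine Eq.trans ?_ (T.assoc _ _ _ _ hi' c₅ _ _)
    refine Eq.trans (T.dom_star_id g (T.cod_dom _)).symm (T.comp_congr ?_ rfl)
    exact (h'.symm.trans (T.inv_star hT k hi').symm)
  have c₈ : T.cod (T.star (T.star (T.inv hT k) f c₂) k c₆) = T.dom (T.inv hT k) := by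
    rw [cod_star, hi]
  have c₉ : T.cod (T.star (T.inv hT k) f c₂) = T.dom (T.star k (T.inv hT k) c₇) := by
    rw [dom_star, c₆]
  refine (T.comp_congr (h := c₁) e₁ rfl).trans ?_
  refine (T.assoc _ _ _ _ c₆ c₈ c₇ c₉).trans ?_
  have c₁₀ : T.cod (T.star (T.inv hT k) f c₂) =
      T.dom (T.cod (T.star (T.inv hT k) f c₂)) := (T.dom_cod _).symm
  refine (T.comp_congr rfl ?_).trans (T.star_cod_id _ c₁₀)
  exact (T.star_inv hT k c₇).trans c₆.symm

theorem Conj.trans {T : NCat.{u} (n + 1)} {f g l : T.Cell} (hg : T.IsClosed g)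
    (hfg : T.Conj f g) (hgl : T.Conj g l) : T.Conj f l := by
  obtain ⟨k, h, h', e⟩ := hfg
  obtain ⟨k₂, h₂, h₂', e₂⟩ := hgl
  unfold IsClosed at hg
  have c : T.cod k = T.dom k₂ := by rw [h', hg, h₂]
  have c₁ : T.cod f = T.dom (T.star k k₂ c) := by rw [dom_star, h]
  have c₂ : T.cod (T.star k k₂ c) = T.dom l := by rw [cod_star, h₂']
  have c₃ : T.cod (T.star f k h) = T.dom k₂ := by rw [cod_star, c]
  have c₄ : T.cod (T.star k g h') = T.dom k₂ := by rw [cod_star, h₂]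
  have c₅ : T.cod k = T.dom (T.star g k₂ h₂) := by rw [dom_star, h']
  have c₆ : T.cod k = T.dom (T.star k₂ l h₂') := by rw [dom_star, c]
  refine ⟨T.star k k₂ c, c₁, c₂, ?_⟩
  refine (T.assoc _ _ _ _ h c₃ c c₁).symm.trans ?_
  refine (T.comp_congr e rfl).trans ?_
  refine (T.assoc _ _ _ _ h' c₄ h₂ c₅).trans ?_
  refine (T.comp_congr rfl e₂).trans ?_
  exact (T.assoc _ _ _ _ c c₂ h₂' c₆).symm

theorem Conj.comp {T : NCat.{u} (n + 1)} {f f' g g' : T.Cell} (i : Fin n) (hf : T.Conj f f')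
    (hg : T.Conj g g') (h : T.tgt i.castSucc f = T.src i.castSucc g)
    (h' : T.tgt i.castSucc f' = T.src i.castSucc g') :
    T.Conj (T.comp i.castSucc f g h) (T.comp i.castSucc f' g' h') := by
  obtain ⟨k, a, a', e⟩ := hf
  obtain ⟨l, b, b', e'⟩ := hg
  have hk : T.tgt i.castSucc k = T.src i.castSucc l := by
    rw [← T.tgt_dom i k, ← a, T.tgt_cod, h, ← T.src_cod i g, b, T.src_dom]
  refine ⟨T.comp i.castSucc k l hk, T.cond_comp_comp i a b h hk,
    T.cond_comp_comp i a' b' hk h', ?_⟩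
  refine (T.comp_star_star i a b h hk (T.cond_star_star i a b h) _).symm.trans ?_
  refine Eq.trans ?_ (T.comp_star_star i a' b' hk h' (T.cond_star_star i a' b' hk) _)
  exact T.comp_congr e e'

/-- In a track category, congruent closed cells are conjugate. -/
theorem conj_of_cong (T : NCat.{u} (n + 1)) (hT : T.IsTrack) {f g : T.closedCells.Cell}
    (hfg : T.cycRel.Cong f g) : T.Conj f.1 g.1 := by
  induction hfg with
  | gen p =>
    obtain ⟨⟨f, g⟩, h, h'⟩ := p
    refine ⟨f, (T.cod_star f g h).trans h', h.trans (T.dom_star g f h').symm, ?_⟩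
    exact T.assoc _ _ _ _ _ _ _ _
  | refl f => exact .refl T f.2
  | @symm f g _ ih => exact ih.symm hT f.2 g.2
  | @trans f g l _ _ ih₁ ih₂ => exact ih₁.trans g.2 ih₂
  | comp i h h' _ _ ih₁ ih₂ =>
    exact ih₁.comp i ih₂ (congrArg Subtype.val h) (congrArg Subtype.val h')

/-- `⌊f⌋` only depends on the class of `f` among loops. -/
theorem iar_eq_of_loop (T : NCat.{u} (n + 1)) (hT : T.IsTrack) {v : T.presented.Cell}
    (f g : ClosedOver T v) (h : T.toLoop f.cell f.closed = T.toLoop g.cell g.closed) :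
    T.iar f = T.iar g := by
  obtain ⟨k, c, c', e⟩ := T.conj_of_cong hT (CellExt.cls_eq.1 h)
  change T.cod f.cell = T.dom k at c
  change T.cod k = T.dom g.cell at c'
  change T.star f.cell k c = T.star k g.cell c' at e
  have hf := f.closed
  have hg := g.closed
  unfold IsClosed at hf hg
  have d₁ : T.cod k = T.dom (T.inv hT k) := (T.dom_inv hT k).symm
  have d₂ : T.cod (T.inv hT k) = T.dom k := T.cod_inv hT k
  have d₃ : T.cod (T.star f.cell k c) = T.dom (T.inv hT k) := by rw [cod_star, d₁]
  have d₄ : T.cod (T.inv hT k) = T.dom (T.star f.cell k c) := by rw [dom_star, d₂, hf, c]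
  have d₅ : T.cod f.cell = T.dom (T.star k (T.inv hT k) d₁) := by rw [dom_star, c]
  have d₆ : T.cod (T.inv hT k) = T.dom (T.star k g.cell c') := by rw [dom_star, d₂]
  have d₇ : T.cod (T.star (T.inv hT k) k d₂) = T.dom g.cell := by rw [cod_star, c']
  refine T.iar_cyc (T.star f.cell k c) (T.inv hT k) d₃ d₄ f g ?_ ?_
  · refine Eq.trans ?_ (T.assoc _ _ _ _ c d₃ d₁ d₅).symm
    refine (T.star_cod_id f.cell (T.dom_cod _).symm).symm.trans (T.comp_congr rfl ?_)
    exact c.trans (T.star_inv hT k d₁).symm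
  · refine Eq.trans ?_ (T.comp_congr (h := d₄) rfl e).symm
    refine Eq.trans ?_ (T.assoc _ _ _ _ d₂ d₇ c' d₆)
    refine (T.dom_star_id g.cell (T.cod_dom _)).symm.trans (T.comp_congr ?_ rfl)
    exact c'.symm.trans (T.inv_star hT k d₂).symm

/-- A closed cell representing a loop. -/
def loopRep (T : NCat.{u} (n + 1)) (e : T.loops.Cell) {v : T.presented.Cell}
    (he : T.loopBase.map e = v) : ClosedOver T v where
  cell := (T.cycRel.qout e).1
  closed := (T.cycRel.qout e).2
  base := by
    rw [← T.loopBase_toLoop _ (T.cycRel.qout e).2, ← he]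
    exact congrArg T.loopBase.map (T.cycRel.cls_qout e)

theorem toLoop_loopRep (T : NCat.{u} (n + 1)) (e : T.loops.Cell) {v : T.presented.Cell}
    (he : T.loopBase.map e = v) :
    T.toLoop (T.loopRep e he).cell (T.loopRep e he).closed = e := T.cycRel.cls_qout e

theorem parallel_loop (T : NCat.{u} (n + 1)) (hT : T.IsTrack) (e : T.loops.Cell) :
    T.loops.Parallel ((T.idLoop hT).map (T.loopBase.map e)) e := by
  obtain ⟨f, rfl⟩ := T.cycRel.cls_surj e
  have h₁ : T.loopBase.map (T.cycRel.cls f) = T.cells.cls (T.bdom f.1) :=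
    T.loopBase_toLoop f.1 f.2
  rw [h₁, T.idLoop_cls hT]
  intro i
  constructor
  · refine (T.cycRel.qsrc_cls i _).trans (Eq.trans ?_ (T.cycRel.qsrc_cls i _).symm)
    exact congrArg T.cycRel.cls (Subtype.ext (T.src_dom i f.1))
  · refine (T.cycRel.qtgt_cls i _).trans (Eq.trans ?_ (T.cycRel.qtgt_cls i _).symm)
    exact congrArg T.cycRel.cls (Subtype.ext (T.tgt_dom i f.1))

theorem parallel_toLoop (T : NCat.{u} (n + 1)) (hT : T.IsTrack) {v : T.presented.Cell}
    (f : ClosedOver T v) :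
    T.loops.Parallel ((T.idLoop hT).map v) (T.toLoop f.cell f.closed) := by
  have := T.parallel_loop hT (T.toLoop f.cell f.closed)
  rwa [T.loopBase_toLoop, f.base] at this

/-- The loop `p[f]`, for `p` a formal composite of cells of the presented `n`-category. -/
def actLoop (T : NCat.{u} (n + 1)) (hT : T.IsTrack) {v w : T.presented.Cell}
    (p : CTerm T.presented v w) (f : ClosedOver T v) : T.loops.Cell :=
  (p.eval (T.idLoop hT) (T.toLoop f.cell f.closed) (T.parallel_toLoop hT f)).1

theorem loopBase_actLoop (T : NCat.{u} (n + 1)) (hT : T.IsTrack) {v w : T.presented.Cell}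
    (p : CTerm T.presented v w) (f : ClosedOver T v) : T.loopBase.map (T.actLoop hT p f) = w :=
  CTerm.map_eval (T.loopBase_idLoop hT) _ _ ((T.loopBase_toLoop _ _).trans f.base) p

/-- A closed cell `B[f]`, for `B` some lift of the context `p`. -/
def act (T : NCat.{u} (n + 1)) (hT : T.IsTrack) {v w : T.presented.Cell}
    (p : CTerm T.presented v w) (f : ClosedOver T v) : ClosedOver T w :=
  T.loopRep (T.actLoop hT p f) (T.loopBase_actLoop hT p f)

theorem toLoop_act (T : NCat.{u} (n + 1)) (hT : T.IsTrack) {v w : T.presented.Cell}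
    (p : CTerm T.presented v w) (f : ClosedOver T v) :
    T.toLoop (T.act hT p f).cell (T.act hT p f).closed = T.actLoop hT p f :=
  T.toLoop_loopRep _ _

theorem star_self (T : NCat.{u} (n + 1)) {z : T.Cell} (hz : T.dom z = z) :
    ∃ h, T.star z z h = z := by
  have hz' : T.cod z = z := by have := T.cod_dom z; rwa [hz] at this
  exact ⟨hz'.trans hz.symm, (T.comp_congr hz.symm rfl).trans (T.dom_star_id z (T.cod_dom z))⟩

theorem comp_star_id (T : NCat.{u} (n + 1)) (i : Fin n) {x y z : T.Cell} (hz : T.dom z = z)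
    (c : T.cod x = T.dom y) (h : T.tgt i.castSucc x = T.src i.castSucc z)
    (h' : T.tgt i.castSucc y = T.src i.castSucc z) (h₁ h₂) :
    T.comp i.castSucc (T.star x y c) z h₁ =
      T.star (T.comp i.castSucc x z h) (T.comp i.castSucc y z h') h₂ := by
  obtain ⟨k, e⟩ := T.star_self hz
  refine (T.comp_congr rfl e.symm).trans (T.comp_star_star i c k h h' ?_ h₂)
  exact T.cond_star_star i c k h

theorem comp_id_star (T : NCat.{u} (n + 1)) (i : Fin n) {x y z : T.Cell} (hz : T.dom z = z)
    (c : T.cod x = T.dom y) (h : T.tgt i.castSucc z = T.src i.castSucc x)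
    (h' : T.tgt i.castSucc z = T.src i.castSucc y) (h₁ h₂) :
    T.comp i.castSucc z (T.star x y c) h₁ =
      T.star (T.comp i.castSucc z x h) (T.comp i.castSucc z y h') h₂ := by
  obtain ⟨k, e⟩ := T.star_self hz
  refine (T.comp_congr e.symm rfl).trans (T.comp_star_star i k c h h' ?_ h₂)
  exact T.cond_star_star i k c h

/-- Contexts act compatibly with the composition of closed cells with a common base. -/
theorem actLoop_star (T : NCat.{u} (n + 1)) (hT : T.IsTrack) {v w : T.presented.Cell}
    (p : CTerm T.presented v w) (hp : p.count = 1) (f g k : ClosedOver T v)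
    (h : T.cod f.cell = T.dom g.cell) (hk : k.cell = T.star f.cell g.cell h) :
    ∃ (x y : T.Cell) (hx : T.IsClosed x) (hy : T.IsClosed y) (c : T.cod x = T.dom y)
      (c' : T.cod y = T.dom x),
      T.actLoop hT p f = T.toLoop x hx ∧ T.actLoop hT p g = T.toLoop y hy ∧
        T.actLoop hT p k = T.toLoop (T.star x y c) (T.isClosed_star_comm c c') := by
  induction p with
  | hole =>
    refine ⟨f.cell, g.cell, f.closed, g.closed, h, ?_, rfl, rfl, ?_⟩
    · exact g.closed.symm.trans (h.symm.trans f.closed.symm)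
    · exact congrArg T.cycRel.cls (Subtype.ext hk)
  | of c => exact absurd hp zero_ne_one
  | @comp i a b q r hab ih₁ ih₂ =>
    simp only [CTerm.count] at hp
    have hcomp : ∀ f' : ClosedOver T v, ∃ h', T.actLoop hT (.comp i q r hab) f' =
        T.loops.comp i (T.actLoop hT q f') (T.actLoop hT r f') h' := fun f' =>
      ⟨NCat.comp_cond (q.eval _ _ (T.parallel_toLoop hT f')).2
        (r.eval _ _ (T.parallel_toLoop hT f')).2 ((T.idLoop hT).cond hab), rfl⟩
    have hcls : ∀ (f' : ClosedOver T v) (x y : T.Cell) (hx : T.IsClosed x) (hy : T.IsClosed y),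
        T.actLoop hT q f' = T.toLoop x hx → T.actLoop hT r f' = T.toLoop y hy →
        ∃ (k : T.tgt i.castSucc x = T.src i.castSucc y)
          (k' : T.IsClosed (T.comp i.castSucc x y k)),
          T.actLoop hT (.comp i q r hab) f' = T.toLoop (T.comp i.castSucc x y k) k' := by
      intro f' x y hx hy ex ey
      obtain ⟨h', e⟩ := hcomp f'
      have e₂ := e.trans (T.loops.comp_congr (h := h') ex ey)
      have h'' : T.loops.tgt i (T.toLoop x hx) = T.loops.src i (T.toLoop y hy) := by
        rw [← ex, ← ey]; exact h'
      have e₃ := e₂.trans (T.cycRel.qcomp_cls i _ _ h'')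
      exact ⟨congrArg Subtype.val (CellExt.cond_of_cls h''), _, e₃⟩
    rcases Nat.eq_zero_or_pos r.count with h0 | hpos
    · obtain ⟨x, y, hx, hy, c, c', ex, ey, e⟩ := ih₁ (by omega)
      obtain ⟨z, rfl⟩ := T.cells.cls_surj b
      have hz : T.dom z.1 = z.1 := z.2
      have er : ∀ f' : ClosedOver T v,
          T.actLoop hT r f' = T.toLoop z.1 (T.idFunctor.map z).2 :=
        fun f' => (CTerm.eval_of_count_eq_zero _ _ _ r h0).trans (T.idLoop_cls hT z)
      obtain ⟨k₁, k₁', e₁⟩ := hcls f _ _ _ _ ex (er f)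
      obtain ⟨k₂, k₂', e₂⟩ := hcls g _ _ _ _ ey (er g)
      obtain ⟨k₃, k₃', e₃⟩ := hcls k _ _ _ _ e (er k)
      obtain ⟨kz, -⟩ := T.star_self hz
      refine ⟨_, _, k₁', k₂', T.cond_comp_comp i c kz k₁ k₂, T.cond_comp_comp i c' kz k₂ k₁,
        e₁, e₂, e₃.trans ?_⟩
      exact congrArg T.cycRel.cls (Subtype.ext (T.comp_star_id i hz c k₁ k₂ _ _))
    · obtain ⟨x, y, hx, hy, c, c', ex, ey, e⟩ := ih₂ (by omega)
      obtain ⟨z, rfl⟩ := T.cells.cls_surj a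
      have hz : T.dom z.1 = z.1 := z.2
      have er : ∀ f' : ClosedOver T v,
          T.actLoop hT q f' = T.toLoop z.1 (T.idFunctor.map z).2 :=
        fun f' => (CTerm.eval_of_count_eq_zero _ _ _ q (by omega)).trans (T.idLoop_cls hT z)
      obtain ⟨k₁, k₁', e₁⟩ := hcls f _ _ _ _ (er f) ex
      obtain ⟨k₂, k₂', e₂⟩ := hcls g _ _ _ _ (er g) ey
      obtain ⟨k₃, k₃', e₃⟩ := hcls k _ _ _ _ (er k) e
      obtain ⟨kz, -⟩ := T.star_self hz
      refine ⟨_, _, k₁', k₂', T.cond_comp_comp i kz c k₁ k₂, T.cond_comp_comp i kz c' k₂ k₁,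
        e₁, e₂, e₃.trans ?_⟩
      exact congrArg T.cycRel.cls (Subtype.ext (T.comp_id_star i hz c k₁ k₂ _ _))

theorem iar_act_eq (T : NCat.{u} (n + 1)) (hT : T.IsTrack) {v w : T.presented.Cell}
    (p : CTerm T.presented v w) (f : ClosedOver T v) (g : ClosedOver T w)
    (h : T.actLoop hT p f = T.toLoop g.cell g.closed) : T.iar (T.act hT p f) = T.iar g :=
  T.iar_eq_of_loop hT _ _ ((T.toLoop_act hT p f).trans h)

/-- A closed cell whose loop is over `w`, as a generator of `Π(T)_w`. -/
def closedOverOf (T : NCat.{u} (n + 1)) {x : T.Cell} (hx : T.IsClosed x) {w : T.presented.Cell}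
    {e : T.loops.Cell} (he : T.loopBase.map e = w) (h : e = T.toLoop x hx) : ClosedOver T w :=
  ⟨x, hx, (T.loopBase_toLoop x hx).symm.trans (h ▸ he)⟩

/-- The action `Π(T)_v → Π(T)_w` of a context from `v` to `w`. -/
def piMap (T : NCat.{u} (n + 1)) (hT : T.IsTrack) {v w : T.presented.Cell}
    (p : CTerm T.presented v w) (hp : p.count = 1) : T.PiGroup v →+ T.PiGroup w :=
  T.piLift (fun f => T.iar (T.act hT p f))
    (fun f g k h hk => by
      obtain ⟨x, y, hx, hy, c, c', ex, ey, e⟩ := T.actLoop_star hT p hp f g k h hk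
      rw [T.iar_act_eq hT p f (T.closedOverOf hx (T.loopBase_actLoop hT p f) ex) ex,
        T.iar_act_eq hT p g (T.closedOverOf hy (T.loopBase_actLoop hT p g) ey) ey,
        T.iar_act_eq hT p k (T.closedOverOf _ (T.loopBase_actLoop hT p k) e) e]
      exact T.iar_add _ _ _ c rfl)
    (fun f g h h' k l hk hl => by
      refine T.iar_eq_of_loop hT _ _ ?_
      rw [T.toLoop_act, T.toLoop_act]
      refine CTerm.eval_congr _ _ _ ?_ p
      have := CellExt.cls_eq.2 (CellExt.Cong.gen (Γ := T.cycRel) ⟨(f, g), h, h'⟩)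
      refine Eq.trans ?_ (this.trans ?_)
      · exact congrArg T.cycRel.cls (Subtype.ext hk)
      · exact congrArg T.cycRel.cls (Subtype.ext hl.symm))

theorem piMap_iar (T : NCat.{u} (n + 1)) (hT : T.IsTrack) {v w : T.presented.Cell}
    (p : CTerm T.presented v w) (hp : p.count = 1) (f : ClosedOver T v) :
    T.piMap hT p hp (T.iar f) = T.iar (T.act hT p f) := T.piLift_iar _ _ _ f

theorem piMap_congr (T : NCat.{u} (n + 1)) (hT : T.IsTrack) {v w : T.presented.Cell}
    {p q : CTerm T.presented v w} (hp : p.count = 1) (hq : q.count = 1) (h : CTerm.Rel p q) :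
    T.piMap hT p hp = T.piMap hT q hq := by
  refine T.pi_hom_ext fun f => ?_
  rw [piMap_iar, piMap_iar]
  exact T.iar_act_eq hT p f _ ((h.eval_eq _ _ _).trans (T.toLoop_act hT q f).symm)

theorem piMap_hole (T : NCat.{u} (n + 1)) (hT : T.IsTrack) (v : T.presented.Cell) :
    T.piMap hT (.hole : CTerm T.presented v v) (CTerm.count_hole v) = AddMonoidHom.id _ := by
  refine T.pi_hom_ext fun f => ?_
  rw [piMap_iar]
  exact T.iar_act_eq hT _ f f rfl

theorem piMap_subst (T : NCat.{u} (n + 1)) (hT : T.IsTrack) {u' v w : T.presented.Cell}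
    (p : CTerm T.presented u' v) (q : CTerm T.presented v w) (hp : p.count = 1)
    (hq : q.count = 1) (hpq : (p.subst q).count = 1) :
    T.piMap hT (p.subst q) hpq = (T.piMap hT q hq).comp (T.piMap hT p hp) := by
  refine T.pi_hom_ext fun f => ?_
  rw [AddMonoidHom.comp_apply, piMap_iar, piMap_iar, piMap_iar]
  refine T.iar_act_eq hT _ f _ ?_
  rw [T.toLoop_act]
  refine (CTerm.eval_subst _ _ _ p q).trans ?_
  exact CTerm.eval_congr _ _ _ (T.toLoop_act hT p f).symm q

/-- The abelian natural system `Π(T)` on the `n`-category presented by a track `(n+1)`-category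
`T`. -/
def Pi (T : NCat.{u} (n + 1)) (hT : T.IsTrack) : AbNaturalSystem T.presented where
  obj v := AddCommGrpCat.of (T.PiGroup v.cell)
  map φ := AddCommGrpCat.ofHom (T.piMap hT (Ctx.rep φ) (Ctx.rep_count φ))
  map_id v := by
    refine congrArg AddCommGrpCat.ofHom ?_
    exact (T.piMap_congr hT _ (CTerm.count_hole _) (Ctx.rep_mkHom _ _)).trans (T.piMap_hole hT v.cell)
  map_comp φ ψ := by
    rw [← AddCommGrpCat.ofHom_comp]
    refine congrArg AddCommGrpCat.ofHom ?_
    refine (T.piMap_congr hT _ _ (Ctx.rep_mkHom _ _)).trans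
      (T.piMap_subst hT _ _ (Ctx.rep_count φ) (Ctx.rep_count ψ) ?_)
    rw [CTerm.count_subst, Ctx.rep_count, Ctx.rep_count]

/-- The closed cell `s(β) ⋆_n t(β)⁻`, for an element `β` of a cellular extension of `T`. -/
def boundaryCell (T : NCat.{u} (n + 1)) (hT : T.IsTrack) (B : CellExt.{u} T) (β : B.Gen) :
    ClosedOver T (T.baseClass (B.s β)) where
  cell := T.star (B.s β) (T.inv hT (B.t β))
    (((B.parallel β (Fin.last n)).2).trans (T.dom_inv hT (B.t β)).symm)
  closed := (T.dom_star _ _ _).trans (((B.parallel β (Fin.last n)).1).trans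
    ((T.cod_star _ _ _).trans (T.cod_inv hT (B.t β))).symm)
  base := T.baseClass_congr (T.dom_star _ _ _)

/-- The elements `⌊s(β) ⋆_n t(β)⁻⌋` of `Π(T)`, for `β` in `B`. -/
def boundaryClasses (T : NCat.{u} (n + 1)) (hT : T.IsTrack) (B : CellExt.{u} T) :
    Set ((v : Ctx T.presented) × (T.Pi hT).obj v) :=
  Set.range fun β => ⟨⟨T.baseClass (B.s β)⟩, T.iar (T.boundaryCell hT B β)⟩

end NCat

namespace Polygraph

variable {n : ℕ}

/-- The abelianized free track `(n+1)`-category of an `(n+1)`-polygraph. -/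
def abTrack (S : Polygraph.{u} (n + 1)) : NCat.{u} (n + 1) := S.freeTrack.abelianization

theorem abTrack_isTrack (S : Polygraph.{u} (n + 1)) : S.abTrack.IsTrack :=
  NCat.abelianization_isTrack S.freeTrack_isTrack

/-- The natural system of identities among relations of an `(n+1)`-polygraph. -/
def Pi (S : Polygraph.{u} (n + 1)) : AbNaturalSystem S.abTrack.presented :=
  S.abTrack.Pi S.abTrack_isTrack

end Polygraph

end

/-! Let `T` be a track `(n+1)`-category with a homotopy basis `B`.  Call a closed cell `f` *spanned*
when `⌊f⌋` lies in the subgroups generated by the elements `C[⌊s β ⋆_n t β⁻⌋]`.  The relations of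
`Π(T)` make spanned cells stable under `⋆_n`, inverses and conjugation; they are stable under `⋆_i`
for `i < n` because a composite of closed cells `f : a → a` and `g : b → b` decomposes as
`f ⋆_i g = (f ⋆_i b) ⋆_n (a ⋆_i g)`, where the two factors are obtained from `f` and `g` by contexts.

It follows, by induction on the congruence (`NCat.LeftDiff.of_cong`), that cells `x ≡_B y` differ by
a spanned cell: `x = k ⋆_n y`.  A closed cell `f` is parallel to the identity on its base, hence
congruent to it, and the corresponding `k` is `f` itself.  So every closed cell is spanned
(`NCat.spanned_of_isHomotopyBasis`), which says that the boundary classes generate `Π(T)`.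

Finally, parallel cells of a quotient have parallel representatives, so the image in a quotient of a
homotopy basis is a homotopy basis (`CellExt.image_isHomotopyBasis`); applied to the abelianization,
this gives the finite homotopy basis, and with it a finite generating set. -/

noncomputable section

/-! ### Subgroups spanned under the action of contexts -/

namespace AbNaturalSystem

variable {n : ℕ} {C : NCat.{u} n}

/-- The subgroup of `D_v` generated by the elements `φ[x]`, for `x ∈ D_u` in the family `X` and `φ`
a context from `u` to `v`. -/
def span (D : AbNaturalSystem C) (X : Set ((u : Ctx C) × D.obj u)) (v : Ctx C) :
    AddSubgroup (D.obj v) :=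
  AddSubgroup.closure {y : D.obj v | ∃ x ∈ X, ∃ φ : x.1 ⟶ v, y = D.map φ x.2}

theorem mem_span (D : AbNaturalSystem C) {X : Set ((u : Ctx C) × D.obj u)}
    {v : Ctx C} {y : D.obj v} (hy : ⟨v, y⟩ ∈ X) : y ∈ D.span X v := by
  refine AddSubgroup.subset_closure ⟨⟨v, y⟩, hy, CategoryTheory.CategoryStruct.id _, ?_⟩
  rw [D.map_id]
  rfl

theorem map_mem_span (D : AbNaturalSystem C) {X : Set ((u : Ctx C) × D.obj u)} {v w : Ctx C}
    (φ : v ⟶ w) {y : D.obj v} (hy : y ∈ D.span X v) : D.map φ y ∈ D.span X w := by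
  unfold span at hy
  induction hy using AddSubgroup.closure_induction with
  | mem y hy =>
    obtain ⟨x, hx, ψ, rfl⟩ := hy
    refine AddSubgroup.subset_closure ⟨x, hx, CategoryTheory.CategoryStruct.comp ψ φ, ?_⟩
    rw [D.map_comp]
    rfl
  | zero => rw [map_zero]; exact zero_mem _
  | add y z _ _ hy hz => rw [map_add]; exact add_mem hy hz
  | neg y _ hy => rw [map_neg]; exact neg_mem hy

end AbNaturalSystem

/-! ### Spanned closed cells -/

namespace NCat

variable {n : ℕ} {T : NCat.{u} (n + 1)} {hT : T.IsTrack}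
  {X : Set ((v : Ctx T.presented) × (T.Pi hT).obj v)}

/-- The subgroup of `Π(T)_v` spanned by a family of elements of `Π(T)`. -/
def piSpan (T : NCat.{u} (n + 1)) (hT : T.IsTrack)
    (X : Set ((v : Ctx T.presented) × (T.Pi hT).obj v)) (v : T.presented.Cell) :
    AddSubgroup (T.PiGroup v) :=
  (T.Pi hT).span X ⟨v⟩

theorem mem_piSpan {v : T.presented.Cell} {y : T.PiGroup v}
    (hy : (⟨⟨v⟩, y⟩ : (v : Ctx T.presented) × (T.Pi hT).obj v) ∈ X) : y ∈ T.piSpan hT X v :=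
  (T.Pi hT).mem_span hy

/-- The cell `f` is closed and `⌊f⌋` is in the subgroup spanned by `X`. -/
def Spanned (T : NCat.{u} (n + 1)) (hT : T.IsTrack)
    (X : Set ((v : Ctx T.presented) × (T.Pi hT).obj v)) (f : T.Cell) : Prop :=
  ∃ hf : T.IsClosed f, T.iar ⟨f, hf, rfl⟩ ∈ T.piSpan hT X (T.baseClass f)

theorem spanned_iff {v : T.presented.Cell} (f : ClosedOver T v) :
    T.Spanned hT X f.cell ↔ T.iar f ∈ T.piSpan hT X v := by
  obtain ⟨f, hf, rfl⟩ := f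
  exact ⟨fun h => h.2, fun h => ⟨hf, h⟩⟩

theorem Spanned.star {f g : T.Cell} (hf : T.Spanned hT X f) (hg : T.Spanned hT X g)
    (h : T.cod f = T.dom g) : T.Spanned hT X (T.star f g h) := by
  have hf' : T.dom f = T.cod f := hf.1
  have hg' : T.dom g = T.cod g := hg.1
  let f' : ClosedOver T (T.baseClass f) := ⟨f, hf.1, rfl⟩
  let g' : ClosedOver T (T.baseClass f) := ⟨g, hg.1, T.baseClass_congr (h.symm.trans hf'.symm)⟩
  let k : ClosedOver T (T.baseClass f) := ⟨T.star f g h,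
    (T.dom_star f g h).trans (hf'.trans (h.trans (hg'.trans (T.cod_star f g h).symm))),
    T.baseClass_congr (T.dom_star f g h)⟩
  refine (spanned_iff k).2 ?_
  rw [T.iar_add f' g' k h rfl]
  exact add_mem ((spanned_iff f').1 hf) ((spanned_iff g').1 hg)

theorem iar_eq_zero {v : T.presented.Cell} (f : ClosedOver T v) (hf : T.dom f.cell = f.cell) :
    T.iar f = 0 := by
  obtain ⟨h, e⟩ := T.star_self hf
  exact left_eq_add.1 (T.iar_add f f f h e.symm)

theorem spanned_of_dom_eq {z : T.Cell} (hz : T.dom z = z) : T.Spanned hT X z := by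
  have hz' : T.cod z = z := by have := T.cod_dom z; rwa [hz] at this
  refine ⟨hz.trans hz'.symm, ?_⟩
  rw [iar_eq_zero _ hz]
  exact zero_mem _

theorem Spanned.star_comm {f g : T.Cell} {h : T.cod f = T.dom g}
    (hfg : T.Spanned hT X (T.star f g h)) (h' : T.cod g = T.dom f) :
    T.Spanned hT X (T.star g f h') := by
  let k : ClosedOver T (T.baseClass (T.star f g h)) := ⟨_, T.isClosed_star_comm h h', rfl⟩
  let l : ClosedOver T (T.baseClass (T.star f g h)) :=
    ⟨_, T.isClosed_star_comm h' h, T.baseClass_star_comm g f h' h⟩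
  refine (spanned_iff l).2 ?_
  rw [← T.iar_cyc f g h h' k l rfl rfl]
  exact (spanned_iff k).1 hfg

theorem Spanned.inv {f : T.Cell} (hf : T.Spanned hT X f) : T.Spanned hT X (T.inv hT f) := by
  have hf' : T.dom f = T.cod f := hf.1
  have h : T.cod f = T.dom (T.inv hT f) := (T.dom_inv hT f).symm
  let f' : ClosedOver T (T.baseClass f) := ⟨f, hf.1, rfl⟩
  let g : ClosedOver T (T.baseClass f) := ⟨T.inv hT f,
    (T.dom_inv hT f).trans (hf'.symm.trans (T.cod_inv hT f).symm),
    T.baseClass_congr ((T.dom_inv hT f).trans hf'.symm)⟩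
  let k : ClosedOver T (T.baseClass f) := ⟨T.dom f, (T.dom_dom f).trans (T.cod_dom f).symm,
    T.baseClass_congr (T.dom_dom f)⟩
  have e : T.iar k = T.iar f' + T.iar g := T.iar_add f' g k h (T.star_inv hT f h).symm
  rw [iar_eq_zero k (T.dom_dom f)] at e
  refine (spanned_iff g).2 ?_
  rw [eq_neg_of_add_eq_zero_right e.symm]
  exact neg_mem ((spanned_iff f').1 hf)

/-- A spanned cell `g` can be moved from the right of a cell `k` to its left, by conjugation. -/
theorem Spanned.exists_conj {g : T.Cell} (hg : T.Spanned hT X g) (k : T.Cell)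
    (h : T.cod k = T.dom g) :
    ∃ (l : T.Cell) (h' : T.cod l = T.dom k), T.Spanned hT X l ∧ T.star l k h' = T.star k g h := by
  have hg' : T.dom g = T.cod g := hg.1
  have hi : T.dom (T.inv hT k) = T.cod k := T.dom_inv hT k
  have hi' : T.cod (T.inv hT k) = T.dom k := T.cod_inv hT k
  have c₁ : T.cod (T.star k g h) = T.dom (T.inv hT k) := by rw [cod_star, hi, ← hg', h]
  have c₂ : T.cod (T.inv hT k) = T.dom (T.star k g h) := by rw [dom_star, hi']
  have c₃ : T.cod (T.star (T.inv hT k) k hi') = T.dom g := by rw [cod_star, h]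
  have c₄ : T.cod (T.star (T.star k g h) (T.inv hT k) c₁) = T.dom k := by rw [cod_star, hi']
  have c₅ : T.cod (T.star k g h) = T.dom (T.star (T.inv hT k) k hi') := by rw [dom_star, c₁]
  refine ⟨T.star (T.star k g h) (T.inv hT k) c₁, c₄, Spanned.star_comm (h := c₂) ?_ _, ?_⟩
  · have e : T.star (T.inv hT k) (T.star k g h) c₂ = g := by
      refine (T.assoc _ _ _ _ hi' c₃ h c₂).symm.trans ?_
      exact (T.comp_congr ((T.inv_star hT k hi').trans h) rfl).trans
        (T.dom_star_id g (T.cod_dom g))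
    rwa [e]
  · refine (T.assoc _ _ _ _ c₁ c₄ hi' c₅).trans ?_
    refine (T.comp_congr rfl ?_).trans (T.star_cod_id (T.star k g h) (T.dom_cod _).symm)
    exact (T.inv_star hT k hi').trans (h.trans (hg'.trans (T.cod_star k g h).symm))

/-! ### Composition of spanned cells in low dimensions -/

theorem piMap_mem_piSpan {v w : T.presented.Cell} (p : CTerm T.presented v w) (hp : p.count = 1)
    {y : T.PiGroup v} (hy : y ∈ T.piSpan hT X v) : T.piMap hT p hp y ∈ T.piSpan hT X w := by
  have := (T.Pi hT).map_mem_span (v := ⟨v⟩) (w := ⟨w⟩) (Ctx.mkHom p hp) hy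
  rw [← T.piMap_congr hT (Ctx.rep_count (Ctx.mkHom p hp)) hp (Ctx.rep_mkHom p hp)]
  exact this

/-- The closed cell `x` is spanned when it represents `p[f]`, for `p` a context and `f` spanned. -/
theorem spanned_of_actLoop {v w : T.presented.Cell} (p : CTerm T.presented v w) (hp : p.count = 1)
    (f : ClosedOver T v) (hf : T.Spanned hT X f.cell) {x : T.Cell} (hx : T.IsClosed x)
    (e : T.actLoop hT p f = T.toLoop x hx) : T.Spanned hT X x := by
  let g : ClosedOver T w := T.closedOverOf hx (T.loopBase_actLoop hT p f) e
  refine (spanned_iff g).2 ?_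
  rw [← T.iar_act_eq hT p f g e, ← T.piMap_iar hT p hp]
  exact piMap_mem_piSpan p hp ((spanned_iff f).1 hf)

/-- Stability under the context `x ↦ x ⋆_i z`, for `z` an `n`-cell. -/
theorem Spanned.comp_id {f z : T.Cell} (hf : T.Spanned hT X f) (hz : T.dom z = z) (i : Fin n)
    (h : T.tgt i.castSucc f = T.src i.castSucc z) :
    T.Spanned hT X (T.comp i.castSucc f z h) := by
  let z' : T.trunc.Cell := ⟨z, hz⟩
  have hb : T.presented.tgt i (T.baseClass f) = T.presented.src i (T.cells.cls z') := by
    refine (T.cells.qtgt_cls i (T.bdom f)).trans (Eq.trans ?_ (T.cells.qsrc_cls i z').symm)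
    exact congrArg T.cells.cls (Subtype.ext ((T.tgt_dom i f).trans h))
  have hl : T.loops.tgt i (T.toLoop f hf.1) =
      T.loops.src i (T.cycRel.cls (T.idFunctor.map z')) := by
    refine (T.cycRel.qtgt_cls i _).trans (Eq.trans ?_ (T.cycRel.qsrc_cls i _).symm)
    exact congrArg T.cycRel.cls (Subtype.ext h)
  refine spanned_of_actLoop (.comp i .hole (.of (T.cells.cls z')) hb) rfl ⟨f, hf.1, rfl⟩ hf
    (T.closedCells.comp i ⟨f, hf.1⟩ (T.idFunctor.map z') (Subtype.ext h)).2 ?_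
  have hl' : T.loops.tgt i (T.toLoop f hf.1) =
      T.loops.src i ((T.idLoop hT).map (T.cells.cls z')) := by
    rw [T.idLoop_cls hT]; exact hl
  exact (T.loops.comp_congr (h := hl') rfl (T.idLoop_cls hT z')).trans (T.cycRel.qcomp_cls i _ _ hl)

/-- Stability under the context `x ↦ z ⋆_i x`, for `z` an `n`-cell. -/
theorem Spanned.id_comp {f z : T.Cell} (hf : T.Spanned hT X f) (hz : T.dom z = z) (i : Fin n)
    (h : T.tgt i.castSucc z = T.src i.castSucc f) :
    T.Spanned hT X (T.comp i.castSucc z f h) := by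
  let z' : T.trunc.Cell := ⟨z, hz⟩
  have hb : T.presented.tgt i (T.cells.cls z') = T.presented.src i (T.baseClass f) := by
    refine (T.cells.qtgt_cls i z').trans (Eq.trans ?_ (T.cells.qsrc_cls i (T.bdom f)).symm)
    exact congrArg T.cells.cls (Subtype.ext (h.trans (T.src_dom i f).symm))
  have hl : T.loops.tgt i (T.cycRel.cls (T.idFunctor.map z')) =
      T.loops.src i (T.toLoop f hf.1) := by
    refine (T.cycRel.qtgt_cls i _).trans (Eq.trans ?_ (T.cycRel.qsrc_cls i _).symm)
    exact congrArg T.cycRel.cls (Subtype.ext h)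
  refine spanned_of_actLoop (.comp i (.of (T.cells.cls z')) .hole hb) rfl ⟨f, hf.1, rfl⟩ hf
    (T.closedCells.comp i (T.idFunctor.map z') ⟨f, hf.1⟩ (Subtype.ext h)).2 ?_
  have hl' : T.loops.tgt i ((T.idLoop hT).map (T.cells.cls z')) =
      T.loops.src i (T.toLoop f hf.1) := by
    rw [T.idLoop_cls hT]; exact hl
  exact (T.loops.comp_congr (h := hl') (T.idLoop_cls hT z') rfl).trans (T.cycRel.qcomp_cls i _ _ hl)

/-- Stability under `⋆_i`, by the exchange relation `f ⋆_i g = (f ⋆_i b) ⋆_n (a ⋆_i g)` for `f : a → a`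
and `g : b → b`. -/
theorem Spanned.comp {f g : T.Cell} (hf : T.Spanned hT X f) (hg : T.Spanned hT X g) (i : Fin n)
    (h : T.tgt i.castSucc f = T.src i.castSucc g) :
    T.Spanned hT X (T.comp i.castSucc f g h) := by
  have hf' : T.dom f = T.cod f := hf.1
  have c₁ : T.cod f = T.dom (T.cod f) := (T.dom_cod f).symm
  have c₂ : T.cod (T.dom g) = T.dom g := T.cod_dom g
  have d₁ : T.tgt i.castSucc f = T.src i.castSucc (T.dom g) := by rw [src_dom, h]
  have d₂ : T.tgt i.castSucc (T.cod f) = T.src i.castSucc g := by rw [tgt_cod, h]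
  have d₃ := T.cond_star_star i c₁ c₂ d₁
  have e : T.comp i.castSucc f g h = T.star _ _ (T.cond_comp_comp i c₁ c₂ d₁ d₂) :=
    (T.comp_congr (h := d₃) (T.star_cod_id f c₁) (T.dom_star_id g c₂)).symm.trans
      (T.comp_star_star i c₁ c₂ d₁ d₂ d₃ _)
  rw [e]
  exact (hf.comp_id (T.dom_dom g) i d₁).star (hg.id_comp (T.dom_cod f) i d₂) _

/-! ### Congruent cells differ by a spanned cell -/

/-- `x = k ⋆_n y` for some spanned closed cell `k`. -/
def LeftDiff (T : NCat.{u} (n + 1)) (hT : T.IsTrack)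
    (X : Set ((v : Ctx T.presented) × (T.Pi hT).obj v)) (x y : T.Cell) : Prop :=
  ∃ (k : T.Cell) (h : T.cod k = T.dom y), T.Spanned hT X k ∧ T.star k y h = x

theorem LeftDiff.refl (x : T.Cell) : T.LeftDiff hT X x x :=
  ⟨T.dom x, T.cod_dom x, spanned_of_dom_eq (T.dom_dom x), T.dom_star_id x _⟩

theorem LeftDiff.symm {x y : T.Cell} (h : T.LeftDiff hT X x y) : T.LeftDiff hT X y x := by
  obtain ⟨k, c, hk, rfl⟩ := h
  have hi : T.cod (T.inv hT k) = T.dom k := T.cod_inv hT k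
  have c₁ : T.cod (T.inv hT k) = T.dom (T.star k y c) := by rw [dom_star, hi]
  have c₂ : T.cod (T.star (T.inv hT k) k hi) = T.dom y := by rw [cod_star, c]
  refine ⟨T.inv hT k, c₁, hk.inv, (T.assoc _ _ _ _ hi c₂ c c₁).symm.trans ?_⟩
  exact (T.comp_congr ((T.inv_star hT k hi).trans c) rfl).trans (T.dom_star_id y (T.cod_dom y))

theorem LeftDiff.trans {x y z : T.Cell} (h : T.LeftDiff hT X x y) (h' : T.LeftDiff hT X y z) :
    T.LeftDiff hT X x z := by
  obtain ⟨l, d, hl, rfl⟩ := h'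
  obtain ⟨k, c, hk, rfl⟩ := h
  have c₁ : T.cod k = T.dom l := c.trans (T.dom_star l z d)
  have c₂ : T.cod (T.star k l c₁) = T.dom z := (T.cod_star k l c₁).trans d
  exact ⟨T.star k l c₁, c₂, hk.star hl c₁, T.assoc _ _ _ _ c₁ c₂ d c⟩

/-- If `x = k ⋆_n x'` and `y = l ⋆_n y'`, then `x ⋆_n y = (k ⋆_n m) ⋆_n (x' ⋆_n y')`, where `m` is
the conjugate of `l` by `x'`. -/
theorem LeftDiff.star {x x' y y' : T.Cell} (hx : T.LeftDiff hT X x x')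
    (hy : T.LeftDiff hT X y y') (h : T.cod x = T.dom y) (h' : T.cod x' = T.dom y') :
    T.LeftDiff hT X (T.star x y h) (T.star x' y' h') := by
  obtain ⟨k, c, hk, rfl⟩ := hx
  obtain ⟨l, d, hl, rfl⟩ := hy
  have c₁ : T.cod x' = T.dom l := by rw [← T.cod_star k x' c, h, dom_star]
  obtain ⟨m, c₂, hm, e⟩ := hl.exists_conj x' c₁
  have c₃ : T.cod k = T.dom m := by
    rw [c, ← T.dom_star x' l c₁, ← e, dom_star]
  have c₄ : T.cod m = T.dom (T.star x' y' h') := by rw [dom_star, c₂]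
  have c₅ : T.cod (T.star k m c₃) = T.dom (T.star x' y' h') := by rw [cod_star, c₄]
  have c₆ : T.cod k = T.dom (T.star m (T.star x' y' h') c₄) := by rw [dom_star, c₃]
  have c₇ : T.cod (T.star m x' c₂) = T.dom y' := by rw [cod_star, h']
  have c₈ : T.cod (T.star x' l c₁) = T.dom y' := by rw [cod_star, d]
  have c₉ : T.cod x' = T.dom (T.star l y' d) := by rw [dom_star, c₁]
  have c₁₀ : T.cod k = T.dom (T.star x' (T.star l y' d) c₉) := by rw [dom_star, c]
  refine ⟨T.star k m c₃, c₅, hk.star hm c₃, ?_⟩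
  refine (T.assoc _ _ _ _ c₃ c₅ c₄ c₆).trans (Eq.trans ?_ (T.assoc _ _ _ _ c h c₉ c₁₀).symm)
  refine T.comp_congr rfl ((T.assoc _ _ _ _ c₂ c₇ h' c₄).symm.trans ?_)
  exact (T.comp_congr e rfl).trans (T.assoc _ _ _ _ c₁ c₈ d c₉)

theorem LeftDiff.comp {x x' y y' : T.Cell} (hx : T.LeftDiff hT X x x')
    (hy : T.LeftDiff hT X y y') (i : Fin n) (h : T.tgt i.castSucc x = T.src i.castSucc y)
    (h' : T.tgt i.castSucc x' = T.src i.castSucc y') :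
    T.LeftDiff hT X (T.comp i.castSucc x y h) (T.comp i.castSucc x' y' h') := by
  obtain ⟨k, c, hk, rfl⟩ := hx
  obtain ⟨l, d, hl, rfl⟩ := hy
  have c₁ : T.tgt i.castSucc k = T.src i.castSucc l := by
    rw [← T.tgt_cod i k, c, T.tgt_dom, h', ← T.src_dom i y', ← d, T.src_cod]
  exact ⟨T.comp i.castSucc k l c₁, T.cond_comp_comp i c d c₁ h', hk.comp hl i c₁,
    (T.comp_star_star i c d c₁ h' h _).symm⟩

/-- If the boundary classes of `B` are in `X`, then `≡_B` implies equality up to a cell spanned by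
`X`. -/
theorem LeftDiff.of_cong {B : CellExt.{u} T} (hB : T.boundaryClasses hT B ⊆ X) {x y : T.Cell}
    (h : B.Cong x y) : T.LeftDiff hT X x y := by
  induction h with
  | gen β =>
    have hi : T.cod (T.inv hT (B.t β)) = T.dom (B.t β) := T.cod_inv hT _
    have c : T.cod (B.s β) = T.dom (T.inv hT (B.t β)) :=
      ((B.parallel β (Fin.last n)).2).trans (T.dom_inv hT (B.t β)).symm
    have c₁ : T.cod (T.boundaryCell hT B β).cell = T.dom (B.t β) := (T.cod_star _ _ _).trans hi
    have c₂ : T.cod (B.s β) = T.dom (T.star (T.inv hT (B.t β)) (B.t β) hi) :=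
      c.trans (T.dom_star _ _ hi).symm
    refine ⟨(T.boundaryCell hT B β).cell, c₁, (spanned_iff _).2 ?_, ?_⟩
    · exact mem_piSpan (hB (Set.mem_range_self β))
    · refine (T.assoc _ _ _ _ c c₁ hi c₂).trans ?_
      refine (T.comp_congr rfl ?_).trans (T.star_cod_id (B.s β) (T.dom_cod _).symm)
      exact (T.inv_star hT (B.t β) hi).trans (B.parallel β (Fin.last n)).2.symm
  | refl x => exact .refl x
  | symm _ ih => exact ih.symm
  | trans _ _ ih₁ ih₂ => exact ih₁.trans ih₂
  | comp i h h' _ _ ih₁ ih₂ =>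
    induction i using Fin.lastCases with
    | last => exact ih₁.star ih₂ h h'
    | cast i => exact ih₁.comp ih₂ i h h'

/-! ### Homotopy bases generate the identities among relations -/

theorem IsClosed.parallel_dom {f : T.Cell} (hf : T.IsClosed f) : T.Parallel f (T.dom f) := by
  intro i
  induction i using Fin.lastCases with
  | last => exact ⟨(T.dom_dom f).symm, Eq.trans hf.symm (T.cod_dom f).symm⟩
  | cast i => exact ⟨(T.src_dom i f).symm, (T.tgt_dom i f).symm⟩

theorem spanned_of_isHomotopyBasis {B : CellExt.{u} T} (hB : B.IsHomotopyBasis)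
    (hBX : T.boundaryClasses hT B ⊆ X) {f : T.Cell} (hf : T.IsClosed f) :
    T.Spanned hT X f := by
  -- `f = k ⋆_n dom f`, so that `f` is the spanned cell `k`
  obtain ⟨k, c, hk, e⟩ := LeftDiff.of_cong hBX (hB f (T.dom f) hf.parallel_dom)
  have hc : T.cod k = T.dom f := c.trans (T.dom_dom f)
  have e' : f = k := by
    refine e.symm.trans ((T.comp_congr rfl hc.symm).trans (T.star_cod_id k (T.dom_cod k).symm))
  rwa [e']

theorem generates_boundaryClasses {B : CellExt.{u} T} (hB : B.IsHomotopyBasis) :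
    (T.Pi hT).Generates (T.boundaryClasses hT B) := by
  rintro ⟨v⟩
  change T.piSpan hT (T.boundaryClasses hT B) v = ⊤
  refine (AddSubgroup.eq_top_iff' _).2 fun y => ?_
  obtain ⟨x, rfl⟩ := QuotientAddGroup.mk_surjective y
  induction x using FreeAbelianGroup.induction_on with
  | zero => exact zero_mem _
  | of f => exact (spanned_iff f).1 (spanned_of_isHomotopyBasis hB subset_rfl f.closed)
  | neg f hf => exact neg_mem hf
  | add x y hx hy => exact add_mem hx hy

end NCat

/-! ### Homotopy bases of quotients -/

namespace CellExt

variable {n : ℕ} {C : NCat.{u} n}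

theorem parallel_of_cls {Γ : CellExt.{u} C} {x y : C.Cell}
    (h : Γ.quotient.Parallel (Γ.cls x) (Γ.cls y)) : C.Parallel x y := by
  intro i
  have hs : Γ.cls (C.src i x) = Γ.cls (C.src i y) :=
    (Γ.qsrc_cls i x).symm.trans ((h i).1.trans (Γ.qsrc_cls i y))
  have ht : Γ.cls (C.tgt i x) = Γ.cls (C.tgt i y) :=
    (Γ.qtgt_cls i x).symm.trans ((h i).2.trans (Γ.qtgt_cls i y))
  have hs' := ((cls_eq.1 hs).parallel i).1
  have ht' := ((cls_eq.1 ht).parallel i).2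
  rw [C.src_src_of_le le_rfl, C.src_src_of_le le_rfl] at hs'
  rw [C.tgt_tgt_of_le le_rfl, C.tgt_tgt_of_le le_rfl] at ht'
  exact ⟨hs', ht'⟩

theorem parallel_cls (Γ : CellExt.{u} C) {x y : C.Cell} (h : C.Parallel x y) :
    Γ.quotient.Parallel (Γ.cls x) (Γ.cls y) := fun i =>
  ⟨(Γ.qsrc_cls i x).trans ((congrArg Γ.cls (h i).1).trans (Γ.qsrc_cls i y).symm),
    (Γ.qtgt_cls i x).trans ((congrArg Γ.cls (h i).2).trans (Γ.qtgt_cls i y).symm)⟩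

/-- The image in the quotient `C / Γ` of a cellular extension of `C`. -/
def image (Γ B : CellExt.{u} C) : CellExt.{u} Γ.quotient where
  Gen := B.Gen
  s β := Γ.cls (B.s β)
  t β := Γ.cls (B.t β)
  parallel β := Γ.parallel_cls (B.parallel β)

/-- The projection onto the quotient `C / Γ`. -/
def proj (Γ : CellExt.{u} C) : NFunctor C Γ.quotient where
  map := Γ.cls
  map_src i x := (Γ.qsrc_cls i x).symm
  map_tgt i x := (Γ.qtgt_cls i x).symm
  map_comp i x y _ h' := (Γ.qcomp_cls i x y h').symm

theorem image_isHomotopyBasis (Γ : CellExt.{u} C) {B : CellExt.{u} C} (hB : B.IsHomotopyBasis) :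
    (Γ.image B).IsHomotopyBasis := by
  intro p q h
  obtain ⟨x, rfl⟩ := Γ.cls_surj p
  obtain ⟨y, rfl⟩ := Γ.cls_surj q
  exact Γ.proj.map_cong (Δ := Γ.image B) (fun β => .gen (Γ := Γ.image B) β)
    (hB x y (parallel_of_cls h))

end CellExt

end

theorem theorem2 {n : ℕ} (S : Polygraph.{u} (n + 1)) (hS : S.FiniteDerivationType) :
    S.Pi.FinitelyGenerated ∧
      (∃ B : CellExt.{u} S.abTrack, Finite B.Gen ∧ B.IsHomotopyBasis) ∧
      ∀ B : CellExt.{u} S.abTrack, B.IsHomotopyBasis →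
        S.Pi.Generates (S.abTrack.boundaryClasses S.abTrack_isTrack B) := by
  obtain ⟨-, B, hfin, hB⟩ := hS
  have hB' := S.freeTrack.commRel.image_isHomotopyBasis hB
  have hfin' : Finite (S.freeTrack.commRel.image B).Gen := hfin
  exact ⟨⟨_, Set.finite_range _, NCat.generates_boundaryClasses hB'⟩, ⟨_, hfin', hB'⟩,
    fun B' h => NCat.generates_boundaryClasses h⟩
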